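/- Let $M$ be a finite-dimensional smooth manifold (Hausdorff and paracompact), let $E\to M$ be a smooth complex vector bundle of rank $n$ (for instance an $SU(n)$-vector bundle, i.e. a hermitian vector bundle with a trivialization of $\bigwedge^n E$), and let $\mathfrak A=\Gamma(\mathrm{End}\,E)$ be the unital algebra of smooth sections of its endomorphism bundle, with center $\mathcal Z(\mathfrak A)$. Let $\mathrm{Der}(\mathfrak A)$ be the Lie algebra and $\mathcal Z(\mathfrak A)$-module of all $\mathbb C$-linear derivations of $\mathfrak A$. Let $\underline\Omega^p_{\mathrm{Der}}(\mathfrak A)$ be the space of $\mathcal Z(\mathfrak A)$-multilinear antisymmetric maps $\mathrm{Der}(\mathfrak A)^p\to\mathfrak A$ (so $\underline\Omega^0_{\mathrm{Der}}(\mathfrak A)=\mathfrak A$), and let $\underline\Omega_{\mathrm{Der}}(\mathfrak A)=\bigoplus_{p\ge 0}\underline\Omega^p_{\mathrm{Der}}(\mathfrak A)$ with the product $$(\omega\eta)(X_1,\dots,X_{p+q})=\frac1{p!\,q!}\sum_{\sigma\in S_{p+q}}\mathrm{sgn}(\sigma)\,\omega(X_{\sigma(1)},\dots,X_{\sigma(p)})\,\eta(X_{\sigma(p+1)},\dots,X_{\sigma(p+q)})$$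 and the differential $$\hat d\omega(X_1,\dots,X_{p+1})=\sum_{i=1}^{p+1}(-1)^{i+1}X_i\,\omega(X_1,\dots,\widehat{X_i},\dots,X_{p+1})+\sum_{1\le i<j\le p+1}(-1)^{i+j}\,\omega([X_i,X_j],\dots,\widehat{X_i},\dots,\widehat{X_j},\dots,X_{p+1}).$$ Let $\Omega_{\mathrm{Der}}(\mathfrak A)\subset\underline\Omega_{\mathrm{Der}}(\mathfrak A)$ be the smallest differential subalgebra containing $\mathfrak A$. Then for every $p\ge 0$ every $\omega\in\underline\Omega^p_{\mathrm{Der}}(\mathfrak A)$ is a finite sum of terms $a_0\,\hat da_1\cdots\hat da_p$ with $a_0,\dots,a_p\in\mathfrak A$, and $\Omega_{\mathrm{Der}}(\mathfrak A)=\underline\Omega_{\mathrm{Der}}(\mathfrak A)$. -/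

import Mathlib

open scoped Manifold ContDiff DirectSum TensorProduct

noncomputable section

namespace DerCalculus

section Algebra

/-- The space `Der A` of all `ℂ`-linear derivations of a (not necessarily commutative)
unital associative complex algebra `A`. -/
def Der (A : Type*) [Ring A] [Algebra ℂ A] : Submodule ℂ (A →ₗ[ℂ] A) where
  carrier := {D | ∀ a b : A, D (a * b) = D a * b + a * D b}
  add_mem' := by
    intro D D' h h' a b
    simp only [LinearMap.add_apply, h a b, h' a b]
    noncomm_ring
  zero_mem' := by
    intro a b
    simp
  smul_mem' := by
    intro c D h a b
    simp only [LinearMap.smul_apply, h a b, smul_add, smul_mul_assoc, mul_smul_comm]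

variable {A : Type*} [Ring A] [Algebra ℂ A]

/-- A derivation acts on the algebra as a function. -/
instance : CoeFun (Der A) (fun _ => A → A) := ⟨fun X => X.1⟩

theorem Der.leibniz (X : Der A) (a b : A) : X (a * b) = X a * b + a * X b := X.2 a b

theorem Der.ext {X Y : Der A} (h : ∀ a, X a = Y a) : X = Y :=
  Subtype.ext (LinearMap.ext h)

@[simp] theorem Der.add_apply (X Y : Der A) (a : A) : (X + Y) a = X a + Y a := rfl

@[simp] theorem Der.sub_apply (X Y : Der A) (a : A) : (X - Y) a = X a - Y a := rfl

@[simp] theorem Der.neg_apply (X : Der A) (a : A) : (-X) a = -X a := rfl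

@[simp] theorem Der.zero_apply (a : A) : (0 : Der A) a = 0 := rfl

/-- The bracket of derivations is the commutator. -/
instance : Bracket (Der A) (Der A) where
  bracket X Y :=
    ⟨X.1 ∘ₗ Y.1 - Y.1 ∘ₗ X.1, fun a b => by
      simp only [LinearMap.sub_apply, LinearMap.comp_apply, Der.leibniz, map_add]
      noncomm_ring⟩

@[simp] theorem Der.lie_apply (X Y : Der A) (a : A) : ⁅X, Y⁆ a = X (Y a) - Y (X a) := rfl

instance : LieRing (Der A) where
  add_lie X Y W := Der.ext fun a => by
    simp only [Der.lie_apply, Der.add_apply, map_add]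
    abel
  lie_add X Y W := Der.ext fun a => by
    simp only [Der.lie_apply, Der.add_apply, map_add]
    abel
  lie_self X := Der.ext fun a => by simp
  leibniz_lie X Y W := Der.ext fun a => by
    simp only [Der.lie_apply, Der.add_apply, map_sub]
    abel

instance : LieAlgebra ℂ (Der A) where
  lie_smul c X Y := Der.ext fun a => by
    change X.1 (c • Y.1 a) - c • Y.1 (X.1 a) = c • (X.1 (Y.1 a) - Y.1 (X.1 a))
    rw [map_smul, smul_sub]

theorem center_smul_def (z : Subalgebra.center ℂ A) (a : A) : z • a = (z : A) * a := rfl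

instance : SMulCommClass (Subalgebra.center ℂ A) A A where
  smul_comm z a b := by
    simp only [center_smul_def, smul_eq_mul, ← mul_assoc,
      (Subalgebra.mem_center_iff.1 z.2 a)]

instance : IsScalarTower (Subalgebra.center ℂ A) A A where
  smul_assoc z a b := by simp [center_smul_def, mul_assoc]

/-- `Der A` is a module over the center `Z(A)` by `(z • X) a = z * X a`. -/
instance : SMul (Subalgebra.center ℂ A) (Der A) where
  smul z X :=
    ⟨{ toFun := fun a => (z : A) * X a
       map_add' := fun a b => by rw [map_add, mul_add]
       map_smul' := fun c a => by rw [map_smul, mul_smul_comm, RingHom.id_apply] },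
     fun a b => by
      change (z : A) * X (a * b) = (z : A) * X a * b + a * ((z : A) * X b)
      rw [Der.leibniz, mul_add, ← mul_assoc, ← mul_assoc, ← mul_assoc,
        Subalgebra.mem_center_iff.1 z.2 a]⟩

@[simp] theorem Der.smul_apply (z : Subalgebra.center ℂ A) (X : Der A) (a : A) :
    (z • X) a = (z : A) * X a := rfl

instance : Module (Subalgebra.center ℂ A) (Der A) where
  one_smul X := Der.ext fun a => by simp
  mul_smul z w X := Der.ext fun a => by simp [mul_assoc]
  smul_zero z := Der.ext fun a => by simp
  smul_add z X Y := Der.ext fun a => by simp [mul_add]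
  add_smul z w X := Der.ext fun a => by simp [add_mul]
  zero_smul X := Der.ext fun a => by simp

instance : IsScalarTower ℂ (Subalgebra.center ℂ A) (Der A) where
  smul_assoc c z X := Der.ext fun a => by
    change (c • (z : A)) * X a = c • ((z : A) * X a)
    rw [smul_mul_assoc]

/-- The center is stable under derivations. -/
theorem Der.apply_mem_center (X : Der A) (z : Subalgebra.center ℂ A) :
    X (z : A) ∈ Subalgebra.center ℂ A := by
  rw [Subalgebra.mem_center_iff]
  intro b
  have h := congrArg X (Subalgebra.mem_center_iff.1 z.2 b)
  rw [Der.leibniz, Der.leibniz, Subalgebra.mem_center_iff.1 z.2 (X b), add_comm] at h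
  exact add_right_cancel h

/-- The action of a derivation on the center. -/
def Der.onCenter (X : Der A) (z : Subalgebra.center ℂ A) : Subalgebra.center ℂ A :=
  ⟨X (z : A), Der.apply_mem_center X z⟩

theorem Der.apply_smul (X : Der A) (z : Subalgebra.center ℂ A) (a : A) :
    X (z • a) = z • X a + Der.onCenter X z • a := by
  rw [center_smul_def, Der.leibniz, add_comm]
  rfl

theorem Der.smul_lie_eq (X Y : Der A) (z : Subalgebra.center ℂ A) :
    ⁅z • X, Y⁆ = z • ⁅X, Y⁆ - Der.onCenter Y z • X :=
  Der.ext fun a => by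
    simp only [Der.lie_apply, Der.smul_apply, Der.sub_apply, Der.leibniz, Der.onCenter]
    noncomm_ring

variable (A) in
/-- The `A`-valued `p`-forms: `Z(A)`-multilinear antisymmetric maps `Der A × ⋯ × Der A → A`. -/
abbrev Form (p : ℕ) := (Der A) [⋀^Fin p]→ₗ[Subalgebra.center ℂ A] A

/-- An element of the algebra as a `0`-form. -/
def Form.ofAlg (a : A) : Form A 0 :=
  AlternatingMap.constOfIsEmpty (Subalgebra.center ℂ A) (Der A) (Fin 0) a

/-- The product of forms: `(η ξ) (X₁, …, X_{p+q})` is the sum over all `(p, q)`-shuffles `σ` of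
`sign σ • η (X_{σ 1}, …, X_{σ p}) * ξ (X_{σ (p+1)}, …, X_{σ (p+q)})`. -/
def Form.wedge {p q : ℕ} (η : Form A p) (ξ : Form A q) : Form A (p + q) :=
  ((LinearMap.mul' (Subalgebra.center ℂ A) A).compAlternatingMap
    (AlternatingMap.domCoprod η ξ)).domDomCongr finSumFinEquiv

/-- The part of the differential containing the brackets,
`∑_{k < l} (-1)^(k + l) η ([X_k, X_l], X_0, …, X̂_k, …, X̂_l, …, X_p)` for a `p`-form `η`.
The pair `i ≤ j` below encodes the pair `k = i`, `l = j + 1` (whence the exponent `i + j + 1`),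
and `j.removeNth (i.castSucc.removeNth X)` is the family `X` without its entries `k` and `l`. -/
def Form.bracketPart : {p : ℕ} → Form A p → (Fin (p + 1) → Der A) → A
  | 0, _, _ => 0
  | p + 1, η, X => ∑ i : Fin (p + 1), ∑ j ∈ Finset.Ici i,
      (-1 : ℤ) ^ ((i : ℕ) + (j : ℕ) + 1) •
        η (Matrix.vecCons ⁅X i.castSucc, X j.succ⁆ (j.removeNth (i.castSucc.removeNth X)))

/-- The value of the differential of a `p`-form `η`,
`∑_i (-1)^i X_i (η (X_0, …, X̂_i, …, X_p))
  + ∑_{k < l} (-1)^(k + l) η ([X_k, X_l], X_0, …, X̂_k, …, X̂_l, …, X_p)`. -/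
def Form.dFun {p : ℕ} (η : Form A p) (X : Fin (p + 1) → Der A) : A :=
  ∑ i : Fin (p + 1), (-1 : ℤ) ^ (i : ℕ) • X i (η (i.removeNth X)) + η.bracketPart X

/-- A form, seen as a `ℂ`-multilinear antisymmetric map. -/
def Form.toComplex {p : ℕ} (η : Form A p) : (Der A) [⋀^Fin p]→ₗ[ℂ] A where
  toFun := η
  map_update_add' m i x y := by
    convert η.map_update_add m i x y
  map_update_smul' m i c x := by
    have h := η.map_update_smul m i (c • (1 : Subalgebra.center ℂ A)) x
    rw [smul_assoc, one_smul, smul_assoc, one_smul] at h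
    convert h
  map_eq_zero_of_eq' m i j h hij := η.map_eq_zero_of_eq m h hij

/-- The first part of the differential as an antisymmetric map. -/
def Form.dAltFst {p : ℕ} (η : Form A p) : (Der A) [⋀^Fin (p + 1)]→ₗ[ℂ] A :=
  AlternatingMap.alternatizeUncurryFin
    { toFun := fun X => X.1.compAlternatingMap η.toComplex
      map_add' := fun _ _ => rfl
      map_smul' := fun _ _ => rfl }

/-- The second part of the differential as an antisymmetric map. -/
def Form.dAltSnd : {p : ℕ} → Form A p → (Der A) [⋀^Fin (p + 1)]→ₗ[ℂ] A
  | 0, _ => 0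
  | _ + 1, η => (-(1 / 2) : ℂ) • AlternatingMap.alternatizeUncurryFin
      (AlternatingMap.alternatizeUncurryFinLM ∘ₗ
        LinearMap.mk₂ ℂ (fun X Y : Der A => η.toComplex.curryLeft ⁅X, Y⁆)
          (fun X Y W => by rw [add_lie, map_add])
          (fun c X Y => by rw [smul_lie, map_smul])
          (fun X Y W => by rw [lie_add, map_add])
          (fun c X Y => by rw [lie_smul, map_smul]))

theorem Form.dAlt_apply {p : ℕ} (η : Form A p) (X : Fin (p + 1) → Der A) :
    (η.dAltFst + η.dAltSnd) X = η.dFun X := by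
  rw [AlternatingMap.add_apply, Form.dFun]
  congr 1
  · rw [Form.dAltFst, AlternatingMap.alternatizeUncurryFin_apply]
    rfl
  · cases p with
    | zero => rfl
    | succ p =>
      rw [Form.dAltSnd, AlternatingMap.smul_apply,
        AlternatingMap.alternatizeUncurryFin_alternatizeUncurryFinLM_comp_apply,
        Form.bracketPart, Finset.smul_sum]
      refine Finset.sum_congr rfl fun i _ => ?_
      rw [Finset.smul_sum]
      refine Finset.sum_congr rfl fun j _ => ?_
      rw [LinearMap.mk₂_apply, LinearMap.mk₂_apply, ← lie_skew (X i.castSucc) (X j.succ), map_neg,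
        AlternatingMap.neg_apply, pow_succ, mul_neg_one, neg_smul]
      have e : ∀ v : Fin p → Der A, η.toComplex.curryLeft ⁅X j.succ, X i.castSucc⁆ v
          = η (Matrix.vecCons ⁅X j.succ, X i.castSucc⁆ v) := fun _ => rfl
      have e2 : ∀ v : Fin p → Der A, η (Matrix.vecCons (-⁅X j.succ, X i.castSucc⁆) v)
          = -η (Matrix.vecCons ⁅X j.succ, X i.castSucc⁆ v) := fun v => by
        have := congrArg (fun f => f v) (map_neg η.toComplex.curryLeft ⁅X j.succ, X i.castSucc⁆)
        exact this
      have h (a : A) : (1 / 2 : ℂ) • (-a - a) = -a := by module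
      rw [e, e2, smul_comm, h, neg_smul]

theorem Form.dFun_update_zero_smul {p : ℕ} (η : Form A p) (X : Fin (p + 1) → Der A)
    (z : Subalgebra.center ℂ A) (Y : Der A) :
    η.dFun (Function.update X 0 (z • Y)) = z • η.dFun (Function.update X 0 Y) := by
  cases p with
  | zero => 
    simp [Form.dFun, Form.bracketPart, center_smul_def]
  | succ p =>
    have hrem : ∀ (i : Fin (p + 1)) (W : Der A), i.succ.removeNth (Function.update X 0 W)
        = Matrix.vecCons W (i.removeNth (Fin.tail X)) := by
      intro i W
      ext1 k
      refine Fin.cases ?_ (fun k => ?_) k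
      · simp [Fin.removeNth]
      · simp [Fin.removeNth, Fin.tail]
    have hrem0 : ∀ W : Der A, (0 : Fin (p + 2)).removeNth (Function.update X 0 W) = Fin.tail X := by
      intro W
      ext1 k
      simp [Fin.removeNth, Fin.tail]
    have hcons : ∀ (v : Fin p → Der A) (w : Subalgebra.center ℂ A) (W : Der A),
        η (Matrix.vecCons (w • W) v) = w • η (Matrix.vecCons W v) := fun v w W => by
      exact congrArg (fun f => f v) (map_smul η.curryLeft w W)
    have hsub : ∀ (v : Fin p → Der A) (V W : Der A),
        η (Matrix.vecCons (V - W) v) = η (Matrix.vecCons V v) - η (Matrix.vecCons W v) :=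
      fun v V W => by
      exact congrArg (fun f => f v) (map_sub η.curryLeft V W)
    have hicizero : Finset.Ici (0 : Fin (p + 1)) = Finset.univ := by
      ext k
      simp
    have hrem1 : ∀ (i : Fin p) (j : Fin (p + 1)) (hj : j ∈ Finset.Ici i.succ) (V : Der A),
        ∃ v : Fin p → Der A, ∃ k : Fin p, ∀ W : Der A,
        Matrix.vecCons V (j.removeNth (i.succ.castSucc.removeNth (Function.update X 0 W)))
          = Function.update (Matrix.vecCons V v) k.succ W := by
      intro i j hj V
      obtain ⟨j, rfl⟩ : ∃ j' : Fin p, j = j'.succ := by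
        refine Fin.exists_succ_eq.2 ?_ |>.imp fun _ h => h.symm
        rintro rfl
        simp at hj
      obtain ⟨q, rfl⟩ : ∃ q, p = q + 1 := ⟨p - 1, by have := i.pos; omega⟩
      refine ⟨j.succ.removeNth (i.succ.castSucc.removeNth X), 0, fun W => ?_⟩
      rw [Matrix.vecCons, Matrix.vecCons, ← Fin.cons_update]
      congr 1
      ext1 k
      refine Fin.cases ?_ (fun k => ?_) k
      · simp [Fin.removeNth]
      · simp [Fin.removeNth]
    have hS : ∀ W : Der A, η.dFun (Function.update X 0 W) =
        W (η (Fin.tail X))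
        + ∑ i : Fin (p + 1), (-1 : ℤ) ^ ((i : ℕ) + 1) •
            (X i.succ (η (Matrix.vecCons W (i.removeNth (Fin.tail X))))
              + η (Matrix.vecCons ⁅W, X i.succ⁆ (i.removeNth (Fin.tail X))))
        + ∑ i : Fin p, ∑ j ∈ Finset.Ici i.succ,
            (-1 : ℤ) ^ ((i.succ : ℕ) + (j : ℕ) + 1) •
        η (Matrix.vecCons ⁅X i.succ.castSucc, X j.succ⁆
          (j.removeNth (i.succ.castSucc.removeNth (Function.update X 0 W)))) := by
      intro W
      simp only [Form.dFun, Form.bracketPart]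
      rw [Fin.sum_univ_succ, Fin.sum_univ_succ (fun i : Fin (p + 1) => ∑ j ∈ Finset.Ici i, _),
        hicizero]
      simp only [hrem, hrem0, Function.update_self, Fin.castSucc_zero, smul_add,
        Finset.sum_add_distrib, Fin.val_zero, pow_zero, one_smul, zero_add, Fin.val_succ, ne_eq,
        Fin.succ_ne_zero, not_false_eq_true, Function.update_of_ne, Fin.castSucc_succ]
      abel
    rw [hS, hS, smul_add, smul_add]
    congr 1
    · congr 1
      rw [Finset.smul_sum]
      refine Finset.sum_congr rfl fun i _ => ?_
      rw [smul_comm z, hcons, Der.smul_lie_eq, hsub, hcons, hcons, Der.apply_smul]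
      congr 1
      rw [smul_add]
      abel
    · rw [Finset.smul_sum]
      refine Finset.sum_congr rfl fun i _ => ?_
      rw [Finset.smul_sum]
      refine Finset.sum_congr rfl fun j hj => ?_
      obtain ⟨v, k, hv⟩ := hrem1 i j hj ⁅X i.succ.castSucc, X j.succ⁆
      rw [hv, hv, η.map_update_smul, smul_comm]

/-- The differential of a form. -/
def Form.dForm {p : ℕ} (η : Form A p) : Form A (p + 1) where
  toFun := η.dFun
  map_update_add' m i x y := by
    simp only [← Form.dAlt_apply]
    convert (η.dAltFst + η.dAltSnd).map_update_add m i x y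
  map_update_smul' {inst} m i z x := by
    obtain rfl : inst = instDecidableEqFin _ := Subsingleton.elim _ _
    have key : ∀ y : Der A, η.dFun (Function.update m i y) =
        Equiv.Perm.sign (Equiv.swap 0 i) •
          η.dFun (Function.update (m ∘ Equiv.swap 0 i) 0 y) := fun y => by
      rw [← Form.dAlt_apply, ← Form.dAlt_apply, ← AlternatingMap.map_perm]
      congr 1
      ext1 k
      by_cases hk : k = i
      · subst hk
        simp
      · by_cases h0 : k = 0
        · subst h0
          simp [Function.update, hk, Ne.symm hk]
        · simp [Function.update, hk, Equiv.swap_apply_of_ne_of_ne h0 hk, h0]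
    have h := key (z • x)
    rw [Form.dFun_update_zero_smul, smul_comm, ← key] at h
    convert h
  map_eq_zero_of_eq' m i j h hij := by
    rw [← Form.dAlt_apply]
    exact (η.dAltFst + η.dAltSnd).map_eq_zero_of_eq m h hij

/-- The differential of forms of degree `p`, as a `ℂ`-linear map. -/
def dHat (p : ℕ) : Form A p →ₗ[ℂ] Form A (p + 1) where
  toFun := Form.dForm
  map_add' η ξ := by
    ext X
    change (η + ξ).dFun X = η.dFun X + ξ.dFun X
    cases p with
    | zero => simp [Form.dFun, Form.bracketPart, Finset.sum_add_distrib]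
    | succ p =>
      simp only [Form.dFun, Form.bracketPart, AlternatingMap.add_apply, map_add, smul_add,
        Finset.sum_add_distrib]
      abel
  map_smul' c η := by
    ext X
    change (c • η).dFun X = c • η.dFun X
    cases p with
    | zero => simp [Form.dFun, Form.bracketPart]
    | succ p =>
      simp only [Form.dFun, Form.bracketPart, AlternatingMap.smul_apply, map_smul, smul_add,
        Finset.smul_sum, smul_comm c]

/-- The product `a₀ d̂a₁ ⋯ d̂a_p`, where `a₁, …, a_p` are the entries of the family `a`. -/
def word (a₀ : A) : {p : ℕ} → (Fin p → A) → Form A p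
  | 0, _ => Form.ofAlg a₀
  | p + 1, a => (word a₀ (Fin.init a)).wedge (dHat 0 (Form.ofAlg (a (Fin.last p))))

theorem Form.wedge_eq {p q : ℕ} (η : Form A p) (ξ : Form A q) : η.wedge ξ =
    AlternatingMap.domDomCongr finSumFinEquiv
      ((LinearMap.mul' (Subalgebra.center ℂ A) A).compAlternatingMap
        (AlternatingMap.domCoprod' (η ⊗ₜ[Subalgebra.center ℂ A] ξ))) := rfl

/-- The product of forms makes the direct sum `⨁ p, Form A p` an algebra. -/
instance : DirectSum.GNonUnitalNonAssocSemiring (fun p : ℕ => Form A p) where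
  mul := Form.wedge
  mul_zero η := by
    simp only [Form.wedge_eq, TensorProduct.tmul_zero, map_zero]
    rfl
  zero_mul η := by
    simp only [Form.wedge_eq, TensorProduct.zero_tmul, map_zero]
    rfl
  mul_add η ξ ζ := by
    simp only [Form.wedge_eq, TensorProduct.tmul_add, map_add,
      LinearMap.compAlternatingMap_add, AlternatingMap.domDomCongr_add]
  add_mul η ξ ζ := by
    simp only [Form.wedge_eq, TensorProduct.add_tmul, map_add,
      LinearMap.compAlternatingMap_add, AlternatingMap.domDomCongr_add]

variable (A) in
/-- The graded algebra `⨁ p, Form A p` of all forms (the large calculus). -/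
abbrev OmegaBar := ⨁ p : ℕ, Form A p

variable (A) in
/-- The differential of the large calculus. -/
def OmegaBar.d : OmegaBar A →ₗ[ℂ] OmegaBar A :=
  DirectSum.toModule ℂ ℕ (OmegaBar A) fun p =>
    DirectSum.lof ℂ ℕ (fun p : ℕ => Form A p) (p + 1) ∘ₗ dHat p

variable (A) in
/-- The small calculus: the smallest differential subalgebra of the large calculus, that is, the
smallest `ℂ`-subspace stable under the product and the differential, which contains `A` (as the
space of `0`-forms). -/
def Omega : Submodule ℂ (OmegaBar A) :=
  sInf {S | (∀ a : A, DirectSum.of (fun p : ℕ => Form A p) 0 (Form.ofAlg a) ∈ S) ∧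
    (∀ η ∈ S, ∀ ξ ∈ S, η * ξ ∈ S) ∧ ∀ η ∈ S, OmegaBar.d A η ∈ S}

end Algebra

section Bundle

open Bundle

/-- Composition of complex linear maps is smooth over the reals. -/
theorem contDiff_clmComp (F : Type*) [NormedAddCommGroup F] [NormedSpace ℂ F] :
    ContDiff ℝ ∞ (fun f : (F →L[ℂ] F) × (F →L[ℂ] F) => f.1.comp f.2) :=
  IsBoundedBilinearMap.contDiff
    { add_left := fun f g h => by ext; simp
      smul_left := fun c f g => by ext; simp
      add_right := fun f g h => by ext; simp
      smul_right := fun c f g => by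
        ext v
        exact map_smul f (c : ℂ) (g v)
      bound := ⟨1, one_pos, fun f g => by
        rw [one_mul]
        exact ContinuousLinearMap.opNorm_comp_le f g⟩ }

variable {d : ℕ} (n : ℕ) {M : Type*} [TopologicalSpace M]
  [ChartedSpace (EuclideanSpace ℝ (Fin d)) M]
  (E : M → Type*) [∀ x, AddCommGroup (E x)] [∀ x, Module ℂ (E x)]
  [∀ x, TopologicalSpace (E x)] [∀ x, IsTopologicalAddGroup (E x)] [∀ x, ContinuousSMul ℂ (E x)]
  [TopologicalSpace (TotalSpace (EuclideanSpace ℂ (Fin n)) E)]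
  [FiberBundle (EuclideanSpace ℂ (Fin n)) E] [VectorBundle ℂ (EuclideanSpace ℂ (Fin n)) E]

variable {E} in
/-- A family of fibrewise endomorphisms is smooth if it is smooth as a section of the
bundle `End E` (with typical fibre `End ℂⁿ`) over the real manifold `M`. -/
def IsSmoothEnd (S : ∀ x, E x →L[ℂ] E x) : Prop :=
  ContMDiff (𝓡 d)
    ((𝓡 d).prod 𝓘(ℝ, EuclideanSpace ℂ (Fin n) →L[ℂ] EuclideanSpace ℂ (Fin n))) ∞
    (fun x => (TotalSpace.mk' (EuclideanSpace ℂ (Fin n) →L[ℂ] EuclideanSpace ℂ (Fin n)) x (S x) :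
      TotalSpace (EuclideanSpace ℂ (Fin n) →L[ℂ] EuclideanSpace ℂ (Fin n))
        (fun x => E x →L[ℂ] E x)))

variable {E} in
/-- Smoothness is smoothness of the endomorphism-valued function in local trivializations. -/
theorem isSmoothEnd_iff (S : ∀ x, E x →L[ℂ] E x) :
    IsSmoothEnd (d := d) n S ↔ ∀ x₀ : M,
      ContMDiffAt (𝓡 d) 𝓘(ℝ, EuclideanSpace ℂ (Fin n) →L[ℂ] EuclideanSpace ℂ (Fin n)) ∞
      (fun x => ContinuousLinearMap.inCoordinates (EuclideanSpace ℂ (Fin n)) E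
        (EuclideanSpace ℂ (Fin n)) E x₀ x x₀ x (S x)) x₀ := by
  refine forall_congr' fun x₀ => ?_
  rw [contMDiffAt_section]
  rfl

/-- The algebra `Γ(End E)` of smooth sections of the bundle of endomorphisms of `E`, with
pointwise operations. -/
def EndSec : Subalgebra ℂ (∀ x, E x →L[ℂ] E x) where
  carrier := {S | IsSmoothEnd (d := d) n S}
  mul_mem' := by
    intro S T hS hT
    rw [Set.mem_ofPred_eq, isSmoothEnd_iff] at *
    intro x₀
    refine ((contDiff_clmComp _).contMDiff.contMDiffAt.comp x₀
      ((hS x₀).prodMk_space (hT x₀))).congr_of_eventuallyEq ?_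
    filter_upwards [(trivializationAt (EuclideanSpace ℂ (Fin n)) E x₀).open_baseSet.mem_nhds
      (mem_baseSet_trivializationAt (EuclideanSpace ℂ (Fin n)) E x₀)] with x hx
    ext1 v
    let e := trivializationAt (EuclideanSpace ℂ (Fin n)) E x₀
    change e.continuousLinearMapAt ℂ x (S x (T x (e.symmL ℂ x v))) =
      e.continuousLinearMapAt ℂ x (S x (e.symmL ℂ x (e.continuousLinearMapAt ℂ x
        (T x (e.symmL ℂ x v)))))
    rw [Trivialization.symmL_continuousLinearMapAt _ hx]
  add_mem' := by
    intro S T hS hT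
    rw [Set.mem_ofPred_eq, isSmoothEnd_iff] at *
    intro x₀
    refine ((hS x₀).add (hT x₀)).congr_of_eventuallyEq (.of_forall fun x => ?_)
    simp [ContinuousLinearMap.inCoordinates]
  algebraMap_mem' := by
    intro c
    rw [Set.mem_ofPred_eq, isSmoothEnd_iff] at *
    intro x₀
    refine (contMDiffAt_const (c := c • ContinuousLinearMap.id ℂ _)).congr_of_eventuallyEq ?_
    filter_upwards [(trivializationAt (EuclideanSpace ℂ (Fin n)) E x₀).open_baseSet.mem_nhds
      (mem_baseSet_trivializationAt (EuclideanSpace ℂ (Fin n)) E x₀)] with x hx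
    ext1 v
    simp [ContinuousLinearMap.inCoordinates, Algebra.algebraMap_eq_smul_one,
      Trivialization.continuousLinearMapAt_symmL _ hx]

/-- A complex vector bundle is in particular a real vector bundle. -/
instance realVectorBundle : VectorBundle ℝ (EuclideanSpace ℂ (Fin n)) E where
  trivialization_linear' e _ := ⟨fun x hx =>
    { map_add := (e.linear ℂ hx).map_add
      map_smul := fun c v => (e.linear ℂ hx).map_smul (c : ℂ) v }⟩
  continuousOn_coordChange' e e' _ _ := by
    have h := continuousOn_coordChange ℂ (F := EuclideanSpace ℂ (Fin n)) e e'
    have hc : Continuous fun f : EuclideanSpace ℂ (Fin n) →L[ℂ] EuclideanSpace ℂ (Fin n) =>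
        f.restrictScalars ℝ :=
      (ContinuousLinearMap.restrictScalarsL ℂ (EuclideanSpace ℂ (Fin n))
        (EuclideanSpace ℂ (Fin n)) ℝ ℝ).continuous
    refine (hc.comp_continuousOn h).congr fun x hx => ?_
    ext1 v
    simp [Trivialization.coordChangeL_apply _ _ hx]

end Bundle


end DerCalculus
end

noncomputable section

namespace DerCalculus

set_option linter.unusedSectionVars false

section Words

variable {A : Type*} [Ring A] [Algebra ℂ A]

/-- The multilinear map `(X₁, …, X_p) ↦ a₀ * X₁ a₁ * ⋯ * X_p a_p`. -/
def mono (a₀ : A) : {p : ℕ} → (Fin p → A) →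
    MultilinearMap (Subalgebra.center ℂ A) (fun _ : Fin p => Der A) A
  | 0, _ => (Form.ofAlg a₀).toMultilinearMap
  | p + 1, a => ((LinearMap.mul' (Subalgebra.center ℂ A) A).compMultilinearMap
      (MultilinearMap.domCoprod (mono a₀ (Fin.init a))
        (dHat 0 (Form.ofAlg (a (Fin.last p)))).toMultilinearMap)).domDomCongr finSumFinEquiv

@[simp] theorem mono_zero_apply (a₀ : A) (a : Fin 0 → A) (X : Fin 0 → Der A) :
    mono a₀ a X = a₀ := rfl

theorem dHat_ofAlg_apply (b : A) (X : Fin 1 → Der A) : dHat 0 (Form.ofAlg b) X = X 0 b := by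
  change Form.dFun _ _ = _
  simp [Form.dFun, Form.bracketPart]
  rfl

theorem mono_succ_apply {p : ℕ} (a₀ : A) (a : Fin (p + 1) → A) (X : Fin (p + 1) → Der A) :
    mono a₀ a X = mono a₀ (Fin.init a) (Fin.init X) * X (Fin.last p) (a (Fin.last p)) := by
  rw [← dHat_ofAlg_apply (a (Fin.last p)) fun _ => X (Fin.last p)]
  have : (fun i : Fin 1 => X (finSumFinEquiv (.inr i))) = fun _ => X (Fin.last p) := by
    ext1 i
    obtain rfl := Subsingleton.elim i 0
    rfl
  rw [← this]
  rfl

theorem alternatization_domDomCongr_equiv {R M N ι ι' : Type*} [CommSemiring R] [AddCommMonoid M]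
    [Module R M] [AddCommGroup N] [Module R N] [Fintype ι] [DecidableEq ι] [Fintype ι']
    [DecidableEq ι'] (e : ι ≃ ι') (m : MultilinearMap R (fun _ : ι => M) N) :
    MultilinearMap.alternatization (m.domDomCongr e) =
      (MultilinearMap.alternatization m).domDomCongr e := by
  ext v
  simp only [MultilinearMap.alternatization_apply, AlternatingMap.domDomCongr_apply]
  refine (Fintype.sum_equiv e.permCongr _ _ fun σ => ?_).symm
  rw [Equiv.Perm.sign_permCongr]
  congr 1
  simp only [MultilinearMap.domDomCongr_apply]
  congr 1
  ext1 i
  simp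

theorem word_eq_alternatization {p : ℕ} (a₀ : A) (a : Fin p → A) :
    word a₀ a = MultilinearMap.alternatization (mono a₀ a) := by
  induction p with
  | zero =>
    ext X
    rw [MultilinearMap.alternatization_apply]
    simp [word, mono, Form.ofAlg]
  | succ p ih =>
    rw [word, mono, alternatization_domDomCongr_equiv,
      LinearMap.compMultilinearMap_alternatization, MultilinearMap.domCoprod_alternization,
      AlternatingMap.coe_alternatization, ← ih]
    simp [Form.wedge]

theorem word_apply {p : ℕ} (a₀ : A) (a : Fin p → A) (X : Fin p → Der A) :
    word a₀ a X = ∑ σ : Equiv.Perm (Fin p), Equiv.Perm.sign σ • mono a₀ a (X ∘ σ) := by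
  rw [word_eq_alternatization, MultilinearMap.alternatization_apply]
  rfl

variable (A) in
/-- The complex span of the functions `(X₁, …, X_p) ↦ a₀ * X₁ a₁ * ⋯ * X_p a_p`. -/
def monoSpan (p : ℕ) : Submodule ℂ ((Fin p → Der A) → A) :=
  Submodule.span ℂ (Set.range fun a : A × (Fin p → A) => ⇑(mono a.1 a.2))

theorem mono_mem_monoSpan {p : ℕ} (a₀ : A) (a : Fin p → A) : ⇑(mono a₀ a) ∈ monoSpan A p :=
  Submodule.subset_span ⟨(a₀, a), rfl⟩

theorem monoSpan_mul_eval {p : ℕ} {f : (Fin p → Der A) → A} (hf : f ∈ monoSpan A p) (b : A) :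
    (fun X : Fin (p + 1) → Der A => f (Fin.init X) * X (Fin.last p) b) ∈ monoSpan A (p + 1) := by
  induction hf using Submodule.span_induction with
  | mem f hf =>
    obtain ⟨⟨a₀, a⟩, rfl⟩ := hf
    convert mono_mem_monoSpan a₀ (Fin.snoc a b : Fin (p + 1) → A) using 1
    ext1 X
    simp [mono_succ_apply]
  | zero =>
    simp only [Pi.zero_apply, zero_mul]
    exact zero_mem _
  | add f g _ _ hf hg =>
    convert add_mem hf hg using 1
    ext1 X
    simp [add_mul]
  | smul c f _ hf =>
    convert Submodule.smul_mem _ c hf using 1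
    ext1 X
    simp

theorem monoSpan_mul_right {p : ℕ} {f : (Fin p → Der A) → A} (hf : f ∈ monoSpan A p) (b : A) :
    (fun X => f X * b) ∈ monoSpan A p := by
  induction hf using Submodule.span_induction with
  | mem f hf =>
    obtain ⟨⟨a₀, a⟩, rfl⟩ := hf
    clear f
    induction p generalizing b with
    | zero => exact mono_mem_monoSpan (a₀ * b) a
    | succ p ih =>
      convert sub_mem (monoSpan_mul_eval (mono_mem_monoSpan a₀ (Fin.init a)) (a (Fin.last p) * b))
        (monoSpan_mul_eval (ih (a (Fin.last p)) (Fin.init a)) b) using 1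
      ext1 X
      simp only [mono_succ_apply, Pi.sub_apply, Der.leibniz]
      noncomm_ring
  | zero =>
    simp only [Pi.zero_apply, zero_mul]
    exact zero_mem _
  | add f g _ _ hf hg =>
    convert add_mem hf hg using 1
    ext1 X
    simp [add_mul]
  | smul c f _ hf =>
    convert Submodule.smul_mem _ c hf using 1
    ext1 X
    simp

theorem monoSpan_mul_left {p : ℕ} {f : (Fin p → Der A) → A} (hf : f ∈ monoSpan A p) (b : A) :
    (fun X => b * f X) ∈ monoSpan A p := by
  induction hf using Submodule.span_induction with
  | mem f hf =>
    obtain ⟨⟨a₀, a⟩, rfl⟩ := hf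
    clear f
    convert mono_mem_monoSpan (b * a₀) a using 1
    ext1 X
    induction p with
    | zero => rfl
    | succ p ih =>
      have := ih (Fin.init a) (Fin.init X)
      simp only [mono_succ_apply] at this ⊢
      rw [← this, mul_assoc]
  | zero =>
    simp only [Pi.zero_apply, mul_zero]
    exact zero_mem _
  | add f g _ _ hf hg =>
    convert add_mem hf hg using 1
    ext1 X
    simp [mul_add]
  | smul c f _ hf =>
    convert Submodule.smul_mem _ c hf using 1
    ext1 X
    simp

variable (A) in
/-- The functions `Der A → A` of the form `X ↦ ∑ a * X b`. -/
def oneSpan : Submodule ℂ (Der A → A) :=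
  (monoSpan A 1).comap (LinearMap.funLeft ℂ A fun X : Fin 1 → Der A => X 0)

theorem mem_oneSpan {f : Der A → A} : f ∈ oneSpan A ↔ (fun X => f (X 0)) ∈ monoSpan A 1 := Iff.rfl

theorem eval_mem_oneSpan (b : A) : (fun X : Der A => X b) ∈ oneSpan A := by
  rw [mem_oneSpan]
  convert mono_mem_monoSpan (1 : A) ![b] using 1
  ext1 X
  simp [mono_succ_apply]

theorem oneSpan_mul_left {f : Der A → A} (hf : f ∈ oneSpan A) (b : A) :
    (fun X => b * f X) ∈ oneSpan A := monoSpan_mul_left hf b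

theorem oneSpan_mul_right {f : Der A → A} (hf : f ∈ oneSpan A) (b : A) :
    (fun X => f X * b) ∈ oneSpan A := monoSpan_mul_right hf b

theorem oneSpan_sum {ι : Type*} (s : Finset ι) {f : ι → Der A → A} (hf : ∀ i ∈ s, f i ∈ oneSpan A) :
    (fun X => ∑ i ∈ s, f i X) ∈ oneSpan A := by
  convert sum_mem hf using 1
  ext1 X
  simp

theorem monoSpan_mul_oneSpan {p : ℕ} {f : (Fin p → Der A) → A} (hf : f ∈ monoSpan A p)
    {g : Der A → A} (hg : g ∈ oneSpan A) :
    (fun X : Fin (p + 1) → Der A => f (Fin.init X) * g (X (Fin.last p))) ∈ monoSpan A (p + 1) := by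
  suffices h : ∀ G ∈ monoSpan A 1, (fun X : Fin (p + 1) → Der A =>
      f (Fin.init X) * G fun _ => X (Fin.last p)) ∈ monoSpan A (p + 1) from h _ hg
  intro G hG
  induction hG using Submodule.span_induction with
  | mem G hG =>
    obtain ⟨⟨a₀, a⟩, rfl⟩ := hG
    convert monoSpan_mul_eval (monoSpan_mul_right hf a₀) (a 0) using 1
    ext1 X
    simp [mono_succ_apply, mul_assoc]
  | zero =>
    simp only [Pi.zero_apply, mul_zero]
    exact zero_mem _
  | add f g _ _ hf hg =>
    convert add_mem hf hg using 1
    ext1 X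
    simp [mul_add]
  | smul c f _ hf =>
    convert Submodule.smul_mem _ c hf using 1
    ext1 X
    simp

theorem mul_prod_mem_monoSpan {p : ℕ} (b : A) (φ : Fin p → Der A → Subalgebra.center ℂ A)
    (hφ : ∀ i, (fun X => (φ i X : A)) ∈ oneSpan A) :
    (fun X => b * ((∏ i, φ i (X i) : Subalgebra.center ℂ A) : A)) ∈ monoSpan A p := by
  induction p with
  | zero =>
    convert mono_mem_monoSpan b (Fin.elim0 : Fin 0 → A) using 1
    ext1 X
    simp
  | succ p ih =>
    convert monoSpan_mul_oneSpan (ih (fun i => φ i.castSucc) fun i => hφ i.castSucc)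
      (hφ (Fin.last p)) using 1
    ext1 X
    rw [Fin.prod_univ_castSucc, Subalgebra.coe_mul, mul_assoc]
    rfl

/-- The sums of words of degree `p`. -/
def wordSums (A : Type*) [Ring A] [Algebra ℂ A] (p : ℕ) : Submodule ℂ (Form A p) where
  carrier := {η | ∃ (m : ℕ) (a₀ : Fin m → A) (a : Fin m → Fin p → A), η = ∑ k, word (a₀ k) (a k)}
  zero_mem' := ⟨0, Fin.elim0, fun k => k.elim0, by simp⟩
  add_mem' := by
    rintro _ _ ⟨m, a₀, a, rfl⟩ ⟨m', b₀, b, rfl⟩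
    exact ⟨m + m', Fin.append a₀ b₀, Fin.append a b, by simp [Fin.sum_univ_add]⟩
  smul_mem' := by
    rintro c _ ⟨m, a₀, a, rfl⟩
    refine ⟨m, c • a₀, a, ?_⟩
    rw [Finset.smul_sum]
    refine Finset.sum_congr rfl fun k _ => ?_
    ext X
    have h : ∀ {q : ℕ} (b : Fin q → A) (Y : Fin q → Der A),
        mono (c • a₀ k) b Y = c • mono (a₀ k) b Y := by
      intro q
      induction q with
      | zero => intro b Y; rfl
      | succ q ih => intro b Y; rw [mono_succ_apply, mono_succ_apply, ih, smul_mul_assoc]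
    rw [AlternatingMap.smul_apply, word_apply, word_apply, Finset.smul_sum]
    refine Finset.sum_congr rfl fun σ _ => ?_
    rw [smul_comm, Pi.smul_apply, h]

theorem exists_wordSums_of_mem_monoSpan {p : ℕ} {f : (Fin p → Der A) → A}
    (hf : f ∈ monoSpan A p) :
    ∃ ξ ∈ wordSums A p, ∀ X, ξ X = ∑ σ : Equiv.Perm (Fin p), Equiv.Perm.sign σ • f (X ∘ σ) := by
  induction hf using Submodule.span_induction with
  | mem f hf =>
    obtain ⟨⟨a₀, a⟩, rfl⟩ := hf
    exact ⟨word a₀ a, ⟨1, fun _ => a₀, fun _ => a, by simp⟩, word_apply a₀ a⟩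
  | zero => exact ⟨0, zero_mem _, fun X => by simp⟩
  | add f g _ _ hf hg =>
    obtain ⟨ξ, hξ, h⟩ := hf
    obtain ⟨ξ', hξ', h'⟩ := hg
    exact ⟨ξ + ξ', add_mem hξ hξ', fun X => by simp [h, h', Finset.sum_add_distrib]⟩
  | smul c f _ hf =>
    obtain ⟨ξ, hξ, h⟩ := hf
    refine ⟨c • ξ, Submodule.smul_mem _ c hξ, fun X => ?_⟩
    simp only [AlternatingMap.smul_apply, h, Finset.smul_sum, Pi.smul_apply]
    exact Finset.sum_congr rfl fun σ _ => smul_comm _ _ _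

/-- Multiplication of derivations by the central element `z` has a finite expansion
`z • X = ∑ φ_i X • e_i` with central coefficients `φ_i X` of the form `∑ a * X b`. -/
def HasDualExpansion (z : Subalgebra.center ℂ A) : Prop :=
  ∃ (ι : Type) (_ : Fintype ι) (φ : ι → Der A → Subalgebra.center ℂ A) (e : ι → Der A),
    (∀ i, (fun X => (φ i X : A)) ∈ oneSpan A) ∧ ∀ X, z • X = ∑ i, φ i X • e i

theorem HasDualExpansion.zero : HasDualExpansion (0 : Subalgebra.center ℂ A) :=
  ⟨Empty, inferInstance, fun i => i.elim, fun i => i.elim, fun i => i.elim, fun X => by simp⟩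

theorem HasDualExpansion.add {z w : Subalgebra.center ℂ A} (hz : HasDualExpansion z)
    (hw : HasDualExpansion w) : HasDualExpansion (z + w) := by
  obtain ⟨ι, _, φ, e, hφ, h⟩ := hz
  obtain ⟨ι', _, φ', e', hφ', h'⟩ := hw
  refine ⟨ι ⊕ ι', inferInstance, Sum.elim φ φ', Sum.elim e e', ?_, fun X => ?_⟩
  · rintro (i | i)
    exacts [hφ i, hφ' i]
  · rw [add_smul, h, h', Fintype.sum_sum_type]
    rfl

theorem HasDualExpansion.sum {κ : Type*} (s : Finset κ) {z : κ → Subalgebra.center ℂ A}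
    (hz : ∀ k ∈ s, HasDualExpansion (z k)) : HasDualExpansion (∑ k ∈ s, z k) :=
  Finset.sum_induction z HasDualExpansion (fun _ _ => .add) .zero hz

theorem HasDualExpansion.mem_wordSums (h : HasDualExpansion (1 : Subalgebra.center ℂ A)) {p : ℕ}
    (η : Form A p) : η ∈ wordSums A p := by
  classical
  obtain ⟨ι, _, φ, e, hφ, h⟩ := h
  have key : ⇑η ∈ monoSpan A p := by
    have h1 : ⇑η = ∑ r : Fin p → ι, fun X => η (fun i => e (r i)) *
        ((∏ i, φ (r i) (X i) : Subalgebra.center ℂ A) : A) := by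
      ext1 X
      have hX : X = fun i => ∑ j, φ j (X i) • e j := by
        ext1 i
        rw [← h, one_smul]
      have h2 := η.toMultilinearMap.map_sum fun i j => φ j (X i) • e j
      rw [← hX] at h2
      rw [Finset.sum_apply]
      refine h2.trans (Finset.sum_congr rfl fun r _ => ?_)
      rw [η.toMultilinearMap.map_smul_univ, center_smul_def,
        Subalgebra.mem_center_iff.1 (∏ i, φ (r i) (X i)).2]
      rfl
    rw [h1]
    exact sum_mem fun r _ => mul_prod_mem_monoSpan _ _ fun i => hφ (r i)
  obtain ⟨ξ, hξ, hs⟩ := exists_wordSums_of_mem_monoSpan key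
  have : η = ((p.factorial : ℂ)⁻¹) • ξ := by
    ext X
    rw [AlternatingMap.smul_apply, hs]
    have : ∀ σ : Equiv.Perm (Fin p), Equiv.Perm.sign σ • η (X ∘ σ) = η X := fun σ => by
      rw [AlternatingMap.map_perm, smul_smul, Int.units_mul_self, one_smul]
    rw [Finset.sum_congr rfl fun σ _ => this σ, Finset.sum_const, Finset.card_univ,
      Fintype.card_perm, Fintype.card_fin, ← Nat.cast_smul_eq_nsmul ℂ, smul_smul,
      inv_mul_cancel₀ (Nat.cast_ne_zero.2 p.factorial_ne_zero), one_smul]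
  rw [this]
  exact Submodule.smul_mem _ _ hξ

theorem Omega_eq_top (h : ∀ (p : ℕ) (η : Form A p), η ∈ wordSums A p) : Omega A = ⊤ := by
  rw [eq_top_iff]
  rintro η -
  rw [Omega, Submodule.mem_sInf]
  rintro S ⟨h0, hmul, hd⟩
  have hw : ∀ {p : ℕ} (a₀ : A) (a : Fin p → A),
      DirectSum.of (fun p : ℕ => Form A p) p (word a₀ a) ∈ S := by
    intro p
    induction p with
    | zero => exact fun a₀ _ => h0 a₀
    | succ p ih =>
      intro a₀ a
      have h1 := hd _ (h0 (a (Fin.last p)))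
      have h2 : OmegaBar.d A (DirectSum.of (fun p : ℕ => Form A p) 0
          (Form.ofAlg (a (Fin.last p)))) = DirectSum.of (fun p : ℕ => Form A p) 1
          (dHat 0 (Form.ofAlg (a (Fin.last p)))) :=
        DirectSum.toModule_lof ℂ 0 _
      rw [h2] at h1
      have h3 := hmul _ (ih a₀ (Fin.init a)) _ h1
      rw [DirectSum.of_mul_of] at h3
      exact h3
  induction η using DirectSum.induction_on with
  | zero => exact zero_mem S
  | of p η =>
    obtain ⟨m, a₀, a, rfl⟩ := h p η
    rw [map_sum]
    exact sum_mem fun k _ => hw _ _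
  | add η ξ hη hξ => exact add_mem hη hξ

end Words

section SigmaCompact

open Set Topology

theorem exists_isClopen_isSigmaCompact {X : Type*} [TopologicalSpace X] [T2Space X]
    [WeaklyLocallyCompactSpace X] [ParacompactSpace X] (x : X) :
    ∃ U : Set X, IsClopen U ∧ x ∈ U ∧ IsSigmaCompact U := by
  choose K hK hKx using fun y : X => exists_compact_mem_nhds y
  obtain ⟨V, hVo, hVc, hVf, hVK⟩ := precise_refinement (fun y => interior (K y))
    (fun y => isOpen_interior) (eq_univ_of_forall fun y =>
      mem_iUnion.2 ⟨y, mem_interior_iff_mem_nhds.2 (hKx y)⟩)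
  let T : ℕ → Set X := fun m => Nat.rec {x} (fun _ S => ⋃ i ∈ {i | (V i ∩ S).Nonempty}, K i) m
  have hT : ∀ m, T (m + 1) = ⋃ i ∈ {i | (V i ∩ T m).Nonempty}, K i := fun m => rfl
  have hTc : ∀ m, IsCompact (T m) := by
    intro m
    induction m with
    | zero => exact isCompact_singleton
    | succ m ih =>
      rw [hT]
      exact (hVf.finite_nonempty_inter_compact ih).isCompact_biUnion fun i _ => hK i
  have hcov : ∀ y, ∃ i, y ∈ V i := fun y => mem_iUnion.1 (hVc ▸ mem_univ y)
  refine ⟨⋃ m, T m, ⟨⟨?_⟩, ?_⟩, mem_iUnion.2 ⟨0, rfl⟩, isSigmaCompact_iUnion_of_isCompact _ hTc⟩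
  · rw [isOpen_iff_mem_nhds]
    intro y hy
    obtain ⟨i, hi⟩ := hcov y
    filter_upwards [(hVo i).mem_nhds hi] with z hz hz'
    refine hy ?_
    obtain ⟨m, hm⟩ := mem_iUnion.1 hz'
    refine mem_iUnion.2 ⟨m + 1, ?_⟩
    rw [hT]
    exact mem_biUnion (show i ∈ {i | (V i ∩ T m).Nonempty} from ⟨z, hz, hm⟩)
      (interior_subset (hVK i hi))
  · rw [isOpen_iff_mem_nhds]
    intro y hy
    obtain ⟨m, hm⟩ := mem_iUnion.1 hy
    obtain ⟨i, hi⟩ := hcov y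
    filter_upwards [(hVo i).mem_nhds hi] with z hz
    refine mem_iUnion.2 ⟨m + 1, ?_⟩
    rw [hT]
    exact mem_biUnion (show i ∈ {i | (V i ∩ T m).Nonempty} from ⟨y, hi, hm⟩)
      (interior_subset (hVK i hz))

theorem isSigmaCompact_connectedComponent {X : Type*} [TopologicalSpace X] [T2Space X]
    [WeaklyLocallyCompactSpace X] [ParacompactSpace X] (x : X) :
    IsSigmaCompact (connectedComponent x) := by
  obtain ⟨U, hU, hx, hs⟩ := exists_isClopen_isSigmaCompact x
  exact hs.of_isClosed_subset isClosed_connectedComponent (hU.connectedComponent_subset hx)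

end SigmaCompact

section GeneralPosition

open Set Topology Filter

variable {d : ℕ} {M : Type*} [TopologicalSpace M] [ChartedSpace (EuclideanSpace ℝ (Fin d)) M]
  [IsManifold (𝓡 d) ∞ M] [SigmaCompactSpace M]

theorem dimH_range_le_of_contMDiff {V : Type*} [NormedAddCommGroup V] [NormedSpace ℝ V]
    {g : M → V} (hg : ContMDiff (𝓡 d) 𝓘(ℝ, V) ∞ g) : dimH (range g) ≤ d := by
  have hloc : ∀ x : M, ∃ N ∈ 𝓝 x, dimH (g '' N) ≤ d := by
    intro x
    let φ := chartAt (EuclideanSpace ℝ (Fin d)) x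
    have hx : x ∈ φ.source := mem_chart_source _ x
    obtain ⟨r, hr, hball⟩ := Metric.isOpen_iff.1 φ.open_target (φ x) (φ.map_source hx)
    refine ⟨φ.source ∩ φ ⁻¹' Metric.ball (φ x) r, inter_mem (φ.open_source.mem_nhds hx)
      ((φ.continuousAt hx).preimage_mem_nhds (Metric.ball_mem_nhds _ hr)), ?_⟩
    have hsub : g '' (φ.source ∩ φ ⁻¹' Metric.ball (φ x) r) ⊆
        (g ∘ φ.symm) '' Metric.ball (φ x) r := by
      rintro _ ⟨y, ⟨hy, hy'⟩, rfl⟩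
      exact ⟨φ y, hy', by simp [φ.left_inv hy]⟩
    have hsm : ContDiffOn ℝ 1 (g ∘ φ.symm) (Metric.ball (φ x) r) := by
      rw [← contMDiffOn_iff_contDiffOn]
      exact ((hg.comp_contMDiffOn (contMDiffOn_chart_symm (x := x))).mono hball).of_le
        (by exact_mod_cast le_top)
    calc dimH _ ≤ _ := dimH_mono hsub
      _ ≤ dimH (Metric.ball (φ x) r) := hsm.dimH_image_le (convex_ball _ _) subset_rfl
      _ ≤ dimH (univ : Set (EuclideanSpace ℝ (Fin d))) := dimH_mono (subset_univ _)
      _ = d := by rw [Real.dimH_univ_eq_finrank]; simp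
  choose N hN hdim using hloc
  obtain ⟨s, hs, hcov⟩ := countable_cover_nhds_of_sigmaCompact hN
  rw [← image_univ, ← hcov, image_iUnion₂, dimH_bUnion hs]
  exact iSup₂_le fun x _ => hdim x

theorem exists_isOpenMap_real_Ioo : ∃ θ : ℝ → ℝ, IsOpenMap θ ∧ Continuous θ ∧
    ∀ s, θ s ∈ Ioo (1 / 2 : ℝ) 1 := by
  refine ⟨fun s => 1 / 2 + 1 / 2 * Real.sigmoid s, ?_, by fun_prop, fun s => ?_⟩
  · have h : ∀ s, HasStrictDerivAt (fun s => 1 / 2 + 1 / 2 * Real.sigmoid s)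
        (1 / 2 * (Real.sigmoid s * (1 - Real.sigmoid s))) s := fun s => by
      have := (contDiff_sigmoid.contDiffAt (x := s)).hasStrictDerivAt (by simp)
      rw [Real.deriv_sigmoid] at this
      exact (this.const_mul _).const_add _
    refine isOpenMap_of_hasStrictDerivAt h fun s => ?_
    have := Real.sigmoid_pos s
    have := Real.sigmoid_lt_one s
    have := mul_pos (Real.sigmoid_pos s) (sub_pos.2 this)
    positivity
  · have := Real.sigmoid_pos s
    have := Real.sigmoid_lt_one s
    constructor <;> linarith

/-- For countably many smooth functions on a `d`-dimensional manifold there are levels such that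
no point lies on more than `d` of the level sets. -/
theorem exists_levels {ι : Type*} [Countable ι] {f : ι → M → ℝ}
    (hf : ∀ i, ContMDiff (𝓡 d) 𝓘(ℝ) ∞ (f i)) :
    ∃ t : ι → ℝ, (∀ i, t i ∈ Ioo (1 / 2 : ℝ) 1) ∧
      ∀ (x : M) (S : Finset ι), (∀ i ∈ S, f i x = t i) → S.card ≤ d := by
  obtain ⟨θ, hθo, hθc, hθ⟩ := exists_isOpenMap_real_Ioo
  let g : ∀ S : Finset ι, M → S → ℝ := fun S x i => f i x
  have hg : ∀ S : Finset ι, ContMDiff (𝓡 d) 𝓘(ℝ, S → ℝ) ∞ (g S) := fun S =>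
    contMDiff_pi_space.2 fun i => hf i
  let B : {S : Finset ι // d < S.card} × ℕ → Set (ι → ℝ) := fun q =>
    (fun t (i : q.1.1) => θ (t i)) ⁻¹' (g q.1.1 '' compactCovering M q.2)ᶜ
  have hBo : ∀ q, IsOpen (B q) := fun q =>
    (((isCompact_compactCovering M q.2).image (hg q.1.1).continuous).isClosed.isOpen_compl).preimage
      (by fun_prop)
  have hBd : ∀ q, Dense (B q) := fun q => by
    have h1 : Dense (g q.1.1 '' compactCovering M q.2)ᶜ := by
      refine dense_compl_of_dimH_lt_finrank ?_
      calc dimH _ ≤ dimH (range (g q.1.1)) := dimH_mono (image_subset_range _ _)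
        _ ≤ d := dimH_range_le_of_contMDiff (hg q.1.1)
        _ < _ := by
          simp only [Module.finrank_fintype_fun_eq_card, Fintype.card_coe]
          exact_mod_cast q.1.2
    refine h1.preimage ?_
    have h2 : IsOpenMap (Pi.map fun _ : q.1.1 => θ) :=
      IsOpenMap.piMap (fun _ => hθo) (by simp)
    have h3 : IsOpenMap (fun (t : ι → ℝ) (i : q.1.1) => t i) := by
      classical
      exact isOpenMap_fst.comp
        (Homeomorph.piEquivPiSubtypeProd (· ∈ q.1.1) fun _ => ℝ).isOpenMap
    exact h2.comp h3
  obtain ⟨t, ht⟩ := (dense_iInter_of_isOpen hBo hBd).nonempty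
  refine ⟨fun i => θ (t i), fun i => hθ _, fun x S hS => ?_⟩
  by_contra! hcard
  obtain ⟨m, hm⟩ := exists_mem_compactCovering x
  exact mem_iInter.1 ht (⟨S, hcard⟩, m) ⟨x, hm, funext fun i => hS i i.2⟩

end GeneralPosition

section Colouring

open Set Topology Filter

variable {X ι : Type*} {f : ι → X → ℝ} {t : ι → ℝ}

/-- The values `|f i x - t i|` are below `ε` exactly for the indices `i ∈ S`. -/
def IsNearLevels (f : ι → X → ℝ) (t : ι → ℝ) (S : Finset ι) (ε : ℝ) (x : X) : Prop :=
  0 < ε ∧ ε ≤ 1 / 2 ∧ (∀ i ∈ S, |f i x - t i| < ε) ∧ ∀ i ∉ S, ε < |f i x - t i|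

theorem IsNearLevels.unique {S S' : Finset ι} {ε ε' : ℝ} {x : X} (h : IsNearLevels f t S ε x)
    (h' : IsNearLevels f t S' ε' x) (hc : S.card = S'.card) : S = S' := by
  by_contra hne
  obtain ⟨i, hi, hi'⟩ := Finset.not_subset.1 fun hs => hne (Finset.eq_of_subset_of_card_le hs hc.ge)
  obtain ⟨j, hj, hj'⟩ := Finset.not_subset.1 fun hs =>
    hne (Finset.eq_of_subset_of_card_le hs hc.le).symm
  have h1 := h.2.2.1 i hi
  have h2 := h.2.2.2 j hj'
  have h3 := h'.2.2.1 j hj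
  have h4 := h'.2.2.2 i hi'
  linarith

theorem IsNearLevels.eventually [TopologicalSpace X] (hf : ∀ i, Continuous (f i))
    (hloc : LocallyFinite fun i => Function.support (f i)) (ht : ∀ i, t i ∈ Ioo (1 / 2 : ℝ) 1)
    {S : Finset ι} {ε : ℝ} {x : X} (h : IsNearLevels f t S ε x) :
    ∀ᶠ y in 𝓝 x, IsNearLevels f t S ε y ∧ ∀ i ∉ S, (t i < f i y ↔ t i < f i x) := by
  obtain ⟨h0, h1, h2, h3⟩ := h
  obtain ⟨U, hU, hfin⟩ := hloc x
  have hS : ∀ᶠ y in 𝓝 x, ∀ i ∈ S, |f i y - t i| < ε := by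
    rw [Filter.eventually_all_finset]
    intro i hi
    exact (((hf i).sub continuous_const).abs.continuousAt).eventually_lt_const (h2 i hi)
  have hF : ∀ᶠ y in 𝓝 x, ∀ i ∈ {i | (Function.support (f i) ∩ U).Nonempty},
      i ∉ S → ε < |f i y - t i| ∧ (t i < f i y ↔ t i < f i x) := by
    rw [Filter.eventually_all_finite hfin]
    intro i _
    by_cases hi : i ∈ S
    · simp [hi]
    have e1 : ∀ᶠ y in 𝓝 x, ε < |f i y - t i| :=
      (((hf i).sub continuous_const).abs.continuousAt).eventually_const_lt (h3 i hi)
    rcases lt_trichotomy (f i x) (t i) with hlt | heq | hgt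
    · filter_upwards [e1, (hf i).continuousAt.eventually_lt_const hlt] with y hy hy' _
      exact ⟨hy, iff_of_false hy'.le.not_gt hlt.le.not_gt⟩
    · have := h3 i hi
      rw [heq] at this
      simp at this
      linarith
    · filter_upwards [e1, (hf i).continuousAt.eventually_const_lt hgt] with y hy hy' _
      exact ⟨hy, iff_of_true hy' hgt⟩
  filter_upwards [hS, hF, hU] with y hy1 hy2 hyU
  have key : ∀ i ∉ S, ε < |f i y - t i| ∧ (t i < f i y ↔ t i < f i x) := by
    intro i hi
    by_cases hiF : (Function.support (f i) ∩ U).Nonempty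
    · exact hy2 i hiF hi
    · have hz : ∀ z ∈ U, f i z = 0 := fun z hz => by
        by_contra hne
        exact hiF ⟨z, hne, hz⟩
      have := (ht i).1
      rw [hz y hyU, hz x (mem_of_mem_nhds hU), zero_sub, abs_neg, abs_of_pos (by linarith)]
      exact ⟨by linarith, Iff.rfl⟩
  exact ⟨⟨h0, h1, hy1, fun i hi => (key i hi).1⟩, fun i hi => (key i hi).2⟩

/-- If no point lies on more than `d` of the level sets `f i = t i`, then the space is covered by
`d + 1` open sets, on each of which there is a locally constant choice of an index `i` with
`f i ≠ 0`. -/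
theorem exists_colouring_of_levels [TopologicalSpace X] (hf : ∀ i, Continuous (f i))
    (hloc : LocallyFinite fun i => Function.support (f i)) (ht : ∀ i, t i ∈ Ioo (1 / 2 : ℝ) 1)
    (hone : ∀ x, ∃ i, f i x = 1) {d : ℕ}
    (hd : ∀ (x : X) (S : Finset ι), (∀ i ∈ S, f i x = t i) → S.card ≤ d) :
    ∃ (O : Fin (d + 1) → Set X) (c : Fin (d + 1) → X → ι), (∀ k, IsOpen (O k)) ∧
      (∀ x, ∃ k, x ∈ O k) ∧
      ∀ k, ∀ x ∈ O k, f (c k x) x ≠ 0 ∧ ∀ᶠ y in 𝓝 x, c k y = c k x := by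
  rcases isEmpty_or_nonempty X with hX | ⟨⟨x₀⟩⟩
  · exact ⟨fun _ => ∅, fun _ x => isEmptyElim x, fun _ => isOpen_empty, fun x => isEmptyElim x,
      fun _ x => isEmptyElim x⟩
  have : Nonempty ι := ⟨(hone x₀).choose⟩
  let P : Fin (d + 1) → X → Set ι := fun k x =>
    {i | ∃ S ε, S.card = (k : ℕ) ∧ IsNearLevels f t S ε x ∧ i ∉ S ∧ t i < f i x}
  have hP : ∀ k x, (P k x).Nonempty → ∀ᶠ y in 𝓝 x, P k y = P k x := by
    rintro k x ⟨i, S, ε, hS, h, hi⟩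
    filter_upwards [h.eventually hf hloc ht] with y ⟨hy, hy'⟩
    ext j
    constructor
    · rintro ⟨S', ε', hS', h', hj, hj'⟩
      obtain rfl := h'.unique hy (hS'.trans hS.symm)
      exact ⟨S', ε, hS, h, hj, (hy' j hj).1 hj'⟩
    · rintro ⟨S', ε', hS', h', hj, hj'⟩
      obtain rfl := h'.unique h (hS'.trans hS.symm)
      exact ⟨S', ε, hS, hy, hj, (hy' j hj).2 hj'⟩
  refine ⟨fun k => {x | (P k x).Nonempty}, fun k x => Classical.epsilon (· ∈ P k x), fun k => ?_,
    fun x => ?_, fun k x hx => ⟨?_, ?_⟩⟩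
  · rw [isOpen_iff_mem_nhds]
    intro x hx
    filter_upwards [hP k x hx] with y hy
    rwa [hy]
  · have hfin : {i | f i x ≠ 0}.Finite := hloc.point_finite x
    have hfin' : {i | f i x = t i}.Finite := hfin.subset fun i (hi : f i x = t i) => by
      have := (ht i).1
      change f i x ≠ 0
      rw [hi]
      linarith
    let S := hfin'.toFinset
    have hS : ∀ i, i ∈ S ↔ f i x = t i := fun i => by simp [S]
    obtain ⟨ε, hε, hεlt⟩ : ∃ ε : ℝ, (0 < ε ∧ ε < 1 / 2) ∧
        ∀ i ∈ {i | f i x ≠ 0}, i ∉ S → ε < |f i x - t i| := by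
      have : ∀ᶠ ε in 𝓝[>] (0 : ℝ), ∀ i ∈ {i | f i x ≠ 0}, i ∉ S → ε < |f i x - t i| := by
        rw [Filter.eventually_all_finite hfin]
        intro i _
        by_cases hi : i ∈ S
        · simp [hi]
        · have : 0 < |f i x - t i| := abs_pos.2 (sub_ne_zero.2 fun h => hi ((hS i).2 h))
          filter_upwards [Ioo_mem_nhdsGT this] with ε hε _ using hε.2
      exact (Filter.Eventually.and (Ioo_mem_nhdsGT (by norm_num : (0 : ℝ) < 1 / 2)) this).exists
    obtain ⟨i, hi⟩ := hone x
    have hcard : S.card ≤ d := hd x S fun i hi => (hS i).1 hi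
    refine ⟨⟨S.card, by omega⟩, i, S, ε, rfl, ⟨hε.1, hε.2.le, fun i hi => ?_, fun j hj => ?_⟩, ?_, ?_⟩
    · rw [(hS i).1 hi, sub_self, abs_zero]
      exact hε.1
    · by_cases hj0 : f j x = 0
      · have := (ht j).1
        rw [hj0, zero_sub, abs_neg, abs_of_pos (by linarith)]
        linarith [hε.2]
      · exact hεlt j hj0 hj
    · rw [hS, hi]
      exact (ht i).2.ne'
    · rw [hi]
      exact (ht i).2
  · obtain ⟨S, ε, -, -, -, h⟩ := Classical.epsilon_spec hx
    have := (ht (Classical.epsilon (· ∈ P k x))).1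
    change f (Classical.epsilon (· ∈ P k x)) x ≠ 0
    linarith
  · filter_upwards [hP k x hx] with y hy
    simp only [hy]

end Colouring

section Glue

open Set

variable {M : Type*} [TopologicalSpace M]

/-- A function glued from functions on the members of an open cover `C`. -/
def glueOpens {β : Type*} {C : M → TopologicalSpace.Opens M} (hx : ∀ x, x ∈ C x)
    (G : ∀ U ∈ range C, U → β) (x : M) : β := G (C x) ⟨x, rfl⟩ ⟨x, hx x⟩

theorem glueOpens_eq {β : Type*} {C : M → TopologicalSpace.Opens M} (hx : ∀ x, x ∈ C x)
    (hC : ∀ x y, y ∈ C x → C y = C x) (G : ∀ U ∈ range C, U → β) (x : M) (y : C x) :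
    glueOpens hx G y = G (C x) ⟨x, rfl⟩ y := by
  have : ∀ (U : TopologicalSpace.Opens M) (hU : U ∈ range C) (hy : (y : M) ∈ U), C y = U →
      glueOpens hx G y = G U hU ⟨y, hy⟩ := by
    rintro U hU hy rfl
    rfl
  exact this _ _ y.2 (hC x y y.2)

end Glue

section Covering

open Set Topology Filter

variable {d : ℕ} {M : Type*} [TopologicalSpace M] [ChartedSpace (EuclideanSpace ℝ (Fin d)) M]

/-- Functions `ρ_k`, `χ_k` and maps `c_k` (`k = 0, …, d`) such that the `ρ_k` are a partition of
unity, `χ_k = 1` near the points with `ρ_k ≠ 0`, and around the points near which `χ_k` does not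
vanish identically, `c_k` is locally constant and chooses a member `W (c_k x)` of a given open
cover that contains `x`. -/
structure ColouredPartition (d : ℕ) {M : Type*} [TopologicalSpace M]
    [ChartedSpace (EuclideanSpace ℝ (Fin d)) M] (W : M → Set M) where
  ρ : Fin (d + 1) → M → ℝ
  χ : Fin (d + 1) → M → ℝ
  c : Fin (d + 1) → M → M
  contMDiff_ρ : ∀ k, ContMDiff (𝓡 d) 𝓘(ℝ) ∞ (ρ k)
  contMDiff_χ : ∀ k, ContMDiff (𝓡 d) 𝓘(ℝ) ∞ (χ k)
  sum_ρ : ∀ x, ∑ k, ρ k x = 1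
  χ_eq_one : ∀ k x, ρ k x ≠ 0 → ∀ᶠ y in 𝓝 x, χ k y = 1
  mem : ∀ k x, (∀ᶠ y in 𝓝 x, χ k y = 0) ∨ x ∈ W (c k x) ∧ ∀ᶠ y in 𝓝 x, c k y = c k x

variable [IsManifold (𝓡 d) ∞ M] [T2Space M]

theorem nonempty_colouredPartition_of_sigmaCompact [SigmaCompactSpace M] {W : M → Set M}
    (hW : ∀ x, W x ∈ 𝓝 x) : Nonempty (ColouredPartition d W) := by
  have : LocallyCompactSpace M := Manifold.locallyCompact_of_finiteDimensional (𝓡 d)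
  obtain ⟨ι, f, hf⟩ := SmoothBumpCovering.exists_isSubordinate (𝓡 d) (isClosed_univ (X := M))
    fun x _ => hW x
  have : Countable ι := by
    rw [← countable_univ_iff]
    exact f.locallyFinite.countable_univ fun i => (f i).nonempty_support
  obtain ⟨t, ht, hd⟩ := exists_levels fun i => (f i).contMDiff
  obtain ⟨O, c, hO, hcov, hc⟩ := exists_colouring_of_levels (fun i => (f i).contMDiff.continuous)
    f.locallyFinite ht (fun x => ⟨f.ind x trivial, f.apply_ind x trivial⟩) hd
  obtain ⟨ρ, hρ⟩ := SmoothPartitionOfUnity.exists_isSubordinate (𝓡 d) (isClosed_univ (X := M)) O hO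
    fun x _ => mem_iUnion.2 (hcov x)
  have hdisj : ∀ k, Disjoint (O k)ᶜ (tsupport (ρ k)) := fun k =>
    disjoint_compl_left_iff_subset.2 (hρ k)
  choose χ hχ0 hχ1 _ using fun k => exists_contMDiffMap_zero_one_nhds_of_isClosed (𝓡 d) (n := ⊤)
    (hO k).isClosed_compl (isClosed_tsupport (ρ k)) (hdisj k)
  refine ⟨⟨fun k => ρ k, fun k => χ k, fun k x => f.c (c k x), fun k => (ρ k).contMDiff,
    fun k => (χ k).contMDiff, fun x => ?_, fun k x hx => ?_, fun k x => ?_⟩⟩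
  · have := ρ.sum_eq_one (mem_univ x)
    rwa [finsum_eq_sum_of_fintype] at this
  · exact eventually_nhdsSet_iff_forall.1 (hχ1 k) x (subset_tsupport _ hx)
  · by_cases hx : x ∈ O k
    · right
      refine ⟨hf _ (subset_tsupport _ (hc k x hx).1), ?_⟩
      filter_upwards [(hc k x hx).2] with y hy
      rw [hy]
    · exact .inl (eventually_nhdsSet_iff_forall.1 (hχ0 k) x hx)

variable [ParacompactSpace M]

/-- Every open cover of a paracompact manifold admits a coloured partition. -/
theorem nonempty_colouredPartition {W : M → Set M}
    (hW : ∀ x, W x ∈ 𝓝 x) : Nonempty (ColouredPartition d W) := by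
  have : LocallyCompactSpace M := Manifold.locallyCompact_of_finiteDimensional (𝓡 d)
  have : LocallyConnectedSpace M := ChartedSpace.locallyConnectedSpace (EuclideanSpace ℝ (Fin d)) M
  let C : M → TopologicalSpace.Opens M := fun x => ⟨connectedComponent x, isOpen_connectedComponent⟩
  have hC : ∀ x y, y ∈ C x → C y = C x := fun x y hy =>
    TopologicalSpace.Opens.ext (connectedComponent_eq hy).symm
  have hx : ∀ x, x ∈ C x := fun x => mem_connectedComponent
  have hex : ∀ U ∈ range C, Nonempty
      (ColouredPartition d fun z : U => ((↑) : U → M) ⁻¹' W z) := by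
    rintro _ ⟨x, rfl⟩
    have : SigmaCompactSpace (C x) :=
      isSigmaCompact_iff_sigmaCompactSpace.1 (isSigmaCompact_connectedComponent x)
    exact nonempty_colouredPartition_of_sigmaCompact fun z =>
      continuous_subtype_val.continuousAt.preimage_mem_nhds (hW z)
  let D := fun (U : TopologicalSpace.Opens M) (hU : U ∈ range C) => (hex U hU).some
  have hnhds : ∀ (x : M) {p : M → Prop}, (∀ᶠ z : C x in 𝓝 ⟨x, hx x⟩, p z) → ∀ᶠ y in 𝓝 x, p y :=
    fun x p h => by
      rw [← (C x).isOpen.isOpenEmbedding_subtypeVal.map_nhds_eq ⟨x, hx x⟩]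
      exact h
  have hsm : ∀ (G : ∀ U ∈ range C, U → ℝ), (∀ U hU, ContMDiff (𝓡 d) 𝓘(ℝ) ∞ (G U hU)) →
      ContMDiff (𝓡 d) 𝓘(ℝ) ∞ (glueOpens hx G) := fun G hG x => by
    rw [← contMDiffAt_subtype_iff (U := C x) (x := ⟨x, hx x⟩)]
    convert hG (C x) ⟨x, rfl⟩ ⟨x, hx x⟩ using 1
    ext1 y
    exact glueOpens_eq hx hC G x y
  refine ⟨⟨fun k => glueOpens hx fun U hU => (D U hU).ρ k,
    fun k => glueOpens hx fun U hU => (D U hU).χ k,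
    fun k => glueOpens hx fun U hU z => ((D U hU).c k z : M),
    fun k => hsm _ fun U hU => (D U hU).contMDiff_ρ k,
    fun k => hsm _ fun U hU => (D U hU).contMDiff_χ k,
    fun x => (D (C x) ⟨x, rfl⟩).sum_ρ _, fun k x hne => hnhds x ?_, fun k x => ?_⟩⟩
  · filter_upwards [(D (C x) ⟨x, rfl⟩).χ_eq_one k ⟨x, hx x⟩ hne] with z hz
    rw [glueOpens_eq hx hC]
    exact hz
  · rcases (D (C x) ⟨x, rfl⟩).mem k ⟨x, hx x⟩ with h | ⟨hW, h⟩
    · left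
      refine hnhds x ?_
      filter_upwards [h] with z hz
      rw [glueOpens_eq hx hC]
      exact hz
    · right
      refine ⟨hW, hnhds x ?_⟩
      filter_upwards [h] with z hz
      rw [glueOpens_eq hx hC]
      exact congrArg Subtype.val hz

end Covering

section HadamardLemma

open Set Topology Filter MeasureTheory

universe u

theorem contDiff_intervalIntegral_nat {V : Type u} [NormedAddCommGroup V] [NormedSpace ℝ V]
    [FiniteDimensional ℝ V] (m : ℕ) : ∀ {W : Type u} [NormedAddCommGroup W] [NormedSpace ℝ W]
    {F : V → ℝ → W}, ContDiff ℝ ∞ (Function.uncurry F) →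
      ContDiff ℝ m fun q => ∫ s in (0 : ℝ)..1, F q s := by
  induction m with
  | zero =>
    intro W _ _ F hF
    exact contDiff_zero.2
      (intervalIntegral.continuous_parametric_intervalIntegral_of_continuous' hF.continuous 0 1)
  | succ m ih =>
    intro W _ _ F hF
    let F' : V → ℝ → V →L[ℝ] W := fun q s =>
      (fderiv ℝ (Function.uncurry F) (q, s)).comp (ContinuousLinearMap.inl ℝ V ℝ)
    have hF' : ContDiff ℝ ∞ (Function.uncurry F') :=
      (hF.fderiv_right (m := ∞) (by simp)).clm_comp contDiff_const
    have hderiv : ∀ q s, HasFDerivAt (fun q => F q s) (F' q s) q := fun q s =>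
      HasFDerivAt.comp (g := Function.uncurry F) (f := fun q => (q, s)) q
        (hF.differentiable (by simp) (q, s)).hasFDerivAt (hasFDerivAt_prodMk_left q s)
    have hc : ∀ q, Continuous (F q) := fun q =>
      hF.continuous.comp (Continuous.prodMk_right q)
    have hc' : ∀ q, Continuous (F' q) := fun q =>
      hF'.continuous.comp (Continuous.prodMk_right q)
    push_cast
    refine (contDiff_succ_iff_hasFDerivAt (n := m)).2 ⟨fun q => ∫ s in (0 : ℝ)..1, F' q s,
      ih hF', fun q => ?_⟩
    obtain ⟨C, hC⟩ := ((isCompact_closedBall q 1).prod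
      (isCompact_Icc (a := (0 : ℝ)) (b := 1))).exists_bound_of_continuousOn
        hF'.continuous.continuousOn
    refine intervalIntegral.hasFDerivAt_integral_of_dominated_of_fderiv_le (bound := fun _ => C)
      (Metric.closedBall_mem_nhds q one_pos)
      (Eventually.of_forall fun q => (hc q).aestronglyMeasurable)
      ((hc q).intervalIntegrable _ _) (hc' q).aestronglyMeasurable ?_ intervalIntegrable_const
      (Eventually.of_forall fun s _ q _ => hderiv q s)
    refine Eventually.of_forall fun s hs z hz => hC (z, s) ⟨hz, ?_⟩
    rw [uIoc_of_le zero_le_one] at hs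
    exact ⟨hs.1.le, hs.2⟩

theorem contDiff_intervalIntegral {V W : Type u} [NormedAddCommGroup V] [NormedSpace ℝ V]
    [FiniteDimensional ℝ V] [NormedAddCommGroup W] [NormedSpace ℝ W]
    {F : V → ℝ → W} (hF : ContDiff ℝ ∞ (Function.uncurry F)) :
    ContDiff ℝ ∞ fun q => ∫ s in (0 : ℝ)..1, F q s :=
  contDiff_infty.2 fun m => contDiff_intervalIntegral_nat m hF

/-- Hadamard's lemma. -/
theorem exists_contDiff_eq_add_sum {d : ℕ} {f : EuclideanSpace ℝ (Fin d) → ℂ} (hf : ContDiff ℝ ∞ f)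
    (p : EuclideanSpace ℝ (Fin d)) :
    ∃ G : Fin d → EuclideanSpace ℝ (Fin d) → ℂ, (∀ μ, ContDiff ℝ ∞ (G μ)) ∧
      (∀ q, f q = f p + ∑ μ, ((q μ - p μ : ℝ) : ℂ) * G μ q) ∧
      ∀ μ, G μ p = fderiv ℝ f p (EuclideanSpace.single μ 1) := by
  have hf' : ContDiff ℝ ∞ (fderiv ℝ f) := hf.fderiv_right (by simp)
  refine ⟨fun μ q => ∫ s in (0 : ℝ)..1, fderiv ℝ f (p + s • (q - p)) (EuclideanSpace.single μ 1),
    fun μ => contDiff_intervalIntegral ?_, fun q => ?_, fun μ => by simp⟩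
  · refine ContDiff.clm_apply (hf'.comp ?_) contDiff_const
    exact contDiff_const.add (contDiff_snd.smul (contDiff_fst.sub contDiff_const))
  · have hd : ∀ s : ℝ, HasDerivAt (fun s : ℝ => f (p + s • (q - p)))
        (fderiv ℝ f (p + s • (q - p)) (q - p)) s := fun s => by
      have h1 : HasDerivAt (fun s : ℝ => p + s • (q - p)) (q - p) s := by
        simpa using ((hasDerivAt_id s).smul_const (q - p)).const_add p
      exact ((hf.differentiable (by simp) _).hasFDerivAt).comp_hasDerivAt s h1
    have hcont : Continuous fun s : ℝ => fderiv ℝ f (p + s • (q - p)) :=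
      hf'.continuous.comp (by fun_prop)
    have hint := intervalIntegral.integral_eq_sub_of_hasDerivAt (a := 0) (b := 1)
      (fun s _ => hd s) ((hcont.clm_apply continuous_const).intervalIntegrable _ _)
    have hsum : ∀ T : EuclideanSpace ℝ (Fin d) →L[ℝ] ℂ, T (q - p) =
        ∑ μ, ((q μ - p μ : ℝ) : ℂ) * T (EuclideanSpace.single μ 1) := fun T => by
      have h2 : q - p = ∑ μ, (q μ - p μ) • EuclideanSpace.single μ (1 : ℝ) := by
        ext ν
        simp [Finset.sum_apply, Pi.single_apply]
      conv_lhs => rw [h2]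
      rw [map_sum]
      refine Finset.sum_congr rfl fun μ _ => ?_
      rw [map_smul, Complex.real_smul]
    simp only [hsum] at hint
    rw [intervalIntegral.integral_finsetSum] at hint
    · simp only [intervalIntegral.integral_const_mul] at hint
      rw [hint]
      simp
    · exact fun μ _ => ((hcont.clm_apply continuous_const).const_mul _).intervalIntegrable _ _

/-- The local version of Hadamard's lemma, with globally defined coefficient functions. -/
theorem exists_contDiff_eventually_eq_add_sum {d : ℕ} {f : EuclideanSpace ℝ (Fin d) → ℂ}
    {U : Set (EuclideanSpace ℝ (Fin d))} (hU : IsOpen U) (hf : ContDiffOn ℝ ∞ f U)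
    {p : EuclideanSpace ℝ (Fin d)} (hp : p ∈ U) :
    ∃ G : Fin d → EuclideanSpace ℝ (Fin d) → ℂ, (∀ μ, ContDiff ℝ ∞ (G μ)) ∧
      (∀ᶠ q in 𝓝 p, f q = f p + ∑ μ, ((q μ - p μ : ℝ) : ℂ) * G μ q) ∧
      ∀ μ, G μ p = fderiv ℝ f p (EuclideanSpace.single μ 1) := by
  obtain ⟨r, hr, hball⟩ := Metric.nhds_basis_closedBall.mem_iff.1 (hU.mem_nhds hp)
  let κ : ContDiffBump p := ⟨r / 2, r, half_pos hr, half_lt_self hr⟩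
  have hκ : ∀ᶠ q in 𝓝 p, κ q • f q = f q := by
    filter_upwards [κ.eventuallyEq_one] with q hq
    rw [hq]
    exact one_smul _ _
  have hsm : ContDiff ℝ ∞ fun q => κ q • f q := by
    rw [contDiff_iff_contDiffAt]
    intro q
    by_cases hq : q ∈ U
    · exact κ.contDiff.contDiffAt.smul (hf.contDiffAt (hU.mem_nhds hq))
    · have h0 : ∀ᶠ z in 𝓝 q, κ z = 0 := by
        refine notMem_tsupport_iff_eventuallyEq.1 fun h => hq (hball ?_)
        rwa [κ.tsupport_eq] at h
      refine (contDiffAt_const (c := (0 : ℂ))).congr_of_eventuallyEq ?_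
      filter_upwards [h0] with z hz
      rw [hz, zero_smul]
  obtain ⟨G, hG, hs, hd⟩ := exists_contDiff_eq_add_sum hsm p
  refine ⟨G, hG, ?_, fun μ => ?_⟩
  · filter_upwards [hκ] with q hq
    have := hs q
    rwa [hq, hκ.self_of_nhds] at this
  · rw [hd, Filter.EventuallyEq.fderiv_eq hκ]

end HadamardLemma

section RestrictScalars

variable (F : Type*) [NormedAddCommGroup F] [NormedSpace ℂ F] [FiniteDimensional ℂ F]

theorem exists_leftInverse_restrictScalars :
    ∃ P : (F →L[ℝ] F) →L[ℝ] (F →L[ℂ] F), ∀ f : F →L[ℂ] F, P (f.restrictScalars ℝ) = f := by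
  have : FiniteDimensional ℝ F := FiniteDimensional.complexToReal F
  obtain ⟨P, hP⟩ := LinearMap.exists_leftInverse_of_injective
    (ContinuousLinearMap.restrictScalarsL ℂ F F ℝ ℝ).toLinearMap
    (LinearMap.ker_eq_bot.2 (fun f g h => ContinuousLinearMap.ext fun v => congrArg (fun T => T v) h))
  exact ⟨LinearMap.toContinuousLinearMap P, fun f => LinearMap.congr_fun hP f⟩

end RestrictScalars


section Bundle

open Bundle Filter Topology

variable {d n : ℕ} {M : Type*} [TopologicalSpace M]
  [ChartedSpace (EuclideanSpace ℝ (Fin d)) M]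
  {E : M → Type*} [∀ x, AddCommGroup (E x)] [∀ x, Module ℂ (E x)]
  [∀ x, TopologicalSpace (E x)]
  [TopologicalSpace (TotalSpace (EuclideanSpace ℂ (Fin n)) E)]
  [FiberBundle (EuclideanSpace ℂ (Fin n)) E] [VectorBundle ℂ (EuclideanSpace ℂ (Fin n)) E]

variable (n E) in
/-- The domain of the trivialization of `E` at `b`. -/
abbrev trivSet (b : M) : Set M := (trivializationAt (EuclideanSpace ℂ (Fin n)) E b).baseSet

variable (n) in
/-- An endomorphism of a fibre of `E` in the trivialization at `b`. -/
def toMat (b x : M) (S : E x →L[ℂ] E x) :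
    EuclideanSpace ℂ (Fin n) →L[ℂ] EuclideanSpace ℂ (Fin n) :=
  ((trivializationAt (EuclideanSpace ℂ (Fin n)) E b).continuousLinearMapAt ℂ x).comp
    (S.comp ((trivializationAt (EuclideanSpace ℂ (Fin n)) E b).symmL ℂ x))

variable (E) in
/-- The endomorphism of a fibre of `E` that is given by an endomorphism of `ℂⁿ` in the
trivialization at `b`. -/
def ofMat (b x : M) (B : EuclideanSpace ℂ (Fin n) →L[ℂ] EuclideanSpace ℂ (Fin n)) :
    E x →L[ℂ] E x :=
  ((trivializationAt (EuclideanSpace ℂ (Fin n)) E b).symmL ℂ x).comp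
    (B.comp ((trivializationAt (EuclideanSpace ℂ (Fin n)) E b).continuousLinearMapAt ℂ x))

theorem toMat_ofMat {b x : M} (hx : x ∈ trivSet n E b)
    (B : EuclideanSpace ℂ (Fin n) →L[ℂ] EuclideanSpace ℂ (Fin n)) :
    toMat n b x (ofMat E b x B) = B := by
  ext1 v
  simp [toMat, ofMat, Trivialization.continuousLinearMapAt_symmL _ hx]

theorem ofMat_toMat {b x : M} (hx : x ∈ trivSet n E b) (S : E x →L[ℂ] E x) :
    ofMat E b x (toMat n b x S) = S := by
  ext1 v
  simp only [toMat, ofMat, ContinuousLinearMap.comp_apply,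
    Trivialization.symmL_continuousLinearMapAt _ hx]

theorem ofMat_mul {b x : M} (hx : x ∈ trivSet n E b)
    (B C : EuclideanSpace ℂ (Fin n) →L[ℂ] EuclideanSpace ℂ (Fin n)) :
    ofMat E b x (B * C) = ofMat E b x B * ofMat E b x C := by
  ext1 v
  change _ = ofMat E b x B (ofMat E b x C v)
  simp [ofMat, Trivialization.continuousLinearMapAt_symmL _ hx]

theorem toMat_mul {b x : M} (hx : x ∈ trivSet n E b) (S T : E x →L[ℂ] E x) :
    toMat n b x (S * T) = toMat n b x S * toMat n b x T := by
  ext1 v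
  change _ = toMat n b x S (toMat n b x T v)
  simp only [toMat, ContinuousLinearMap.comp_apply,
    Trivialization.symmL_continuousLinearMapAt _ hx]
  rfl

theorem ofMat_one {b x : M} (hx : x ∈ trivSet n E b) : 
    ofMat E b x (1 : EuclideanSpace ℂ (Fin n) →L[ℂ] EuclideanSpace ℂ (Fin n)) = 1 := by
  ext1 v
  exact Trivialization.symmL_continuousLinearMapAt _ hx v

theorem coordChangeL_eq {b b' x : M} (hx : x ∈ trivSet n E b) (hx' : x ∈ trivSet n E b')
    (v : EuclideanSpace ℂ (Fin n)) :
    (trivializationAt (EuclideanSpace ℂ (Fin n)) E b).coordChangeL ℂ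
        (trivializationAt (EuclideanSpace ℂ (Fin n)) E b') x v =
      (trivializationAt (EuclideanSpace ℂ (Fin n)) E b').continuousLinearMapAt ℂ x
        ((trivializationAt (EuclideanSpace ℂ (Fin n)) E b).symmL ℂ x v) := by
  rw [Trivialization.coordChangeL_apply _ _ ⟨hx, hx'⟩]
  rw [← Trivialization.symmL_apply (R := ℂ) _ hx]
  exact (congrFun (Trivialization.coe_linearMapAt_of_mem (R := ℂ) _ hx') _).symm

variable [∀ x, IsTopologicalAddGroup (E x)] [∀ x, ContinuousSMul ℂ (E x)]

theorem ofMat_add (b x : M) (B C : EuclideanSpace ℂ (Fin n) →L[ℂ] EuclideanSpace ℂ (Fin n)) :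
    ofMat E b x (B + C) = ofMat E b x B + ofMat E b x C := by
  ext1 v
  simp [ofMat]

theorem ofMat_smul (b x : M) (c : ℂ)
    (B : EuclideanSpace ℂ (Fin n) →L[ℂ] EuclideanSpace ℂ (Fin n)) :
    ofMat E b x (c • B) = c • ofMat E b x B := by
  ext1 v
  simp [ofMat]

variable (E) in
/-- `ofMat` as a linear map. -/
def ofMatₗ (b x : M) :
    (EuclideanSpace ℂ (Fin n) →L[ℂ] EuclideanSpace ℂ (Fin n)) →ₗ[ℂ] (E x →L[ℂ] E x) where
  toFun := ofMat E b x
  map_add' := ofMat_add b x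
  map_smul' := ofMat_smul b x

theorem toMat_add (b x : M) (S T : E x →L[ℂ] E x) :
    toMat n b x (S + T) = toMat n b x S + toMat n b x T := by
  ext1 v
  simp [toMat]

theorem toMat_smul (b x : M) (c : ℂ) (S : E x →L[ℂ] E x) :
    toMat n b x (c • S) = c • toMat n b x S := by
  ext1 v
  simp [toMat]

variable [ContMDiffVectorBundle ∞ (EuclideanSpace ℂ (Fin n)) E (𝓡 d)]

variable (n E) in
theorem contMDiffAt_complex_coordChangeL {b b' x₀ : M} (hb : x₀ ∈ trivSet n E b)
    (hb' : x₀ ∈ trivSet n E b') :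
    ContMDiffAt (𝓡 d) 𝓘(ℝ, EuclideanSpace ℂ (Fin n) →L[ℂ] EuclideanSpace ℂ (Fin n)) ∞
      (fun x => ((trivializationAt (EuclideanSpace ℂ (Fin n)) E b).coordChangeL ℂ
        (trivializationAt (EuclideanSpace ℂ (Fin n)) E b') x :
          EuclideanSpace ℂ (Fin n) →L[ℂ] EuclideanSpace ℂ (Fin n))) x₀ := by
  obtain ⟨P, hP⟩ := exists_leftInverse_restrictScalars (EuclideanSpace ℂ (Fin n))
  have h := contMDiffAt_coordChangeL (IB := 𝓡 d) (n := ∞) hb hb'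
  refine (P.contDiff.contMDiff.contMDiffAt.comp x₀ h).congr_of_eventuallyEq ?_
  filter_upwards [(trivializationAt (EuclideanSpace ℂ (Fin n)) E b).open_baseSet.mem_nhds hb,
    (trivializationAt (EuclideanSpace ℂ (Fin n)) E b').open_baseSet.mem_nhds hb'] with x hx hx'
  rw [Function.comp_apply, ← hP (ContinuousLinearEquiv.toContinuousLinearMap _)]
  congr 1
  ext1 v
  simp [Trivialization.coordChangeL_apply _ _ ⟨hx, hx'⟩]

theorem contMDiffAt_toMat_change {S : ∀ x, E x →L[ℂ] E x} {b b' x₀ : M} (hb : x₀ ∈ trivSet n E b)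
    (hb' : x₀ ∈ trivSet n E b')
    (hS : ContMDiffAt (𝓡 d) 𝓘(ℝ, EuclideanSpace ℂ (Fin n) →L[ℂ] EuclideanSpace ℂ (Fin n)) ∞
      (fun x => toMat n b x (S x)) x₀) :
    ContMDiffAt (𝓡 d) 𝓘(ℝ, EuclideanSpace ℂ (Fin n) →L[ℂ] EuclideanSpace ℂ (Fin n)) ∞
      (fun x => toMat n b' x (S x)) x₀ := by
  have hmul := (contDiff_clmComp (EuclideanSpace ℂ (Fin n))).contMDiff
  have h1 := hmul.contMDiffAt.comp x₀ ((contMDiffAt_complex_coordChangeL n E hb hb').prodMk_space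
    (hmul.contMDiffAt.comp x₀ (hS.prodMk_space (contMDiffAt_complex_coordChangeL n E hb' hb))))
  refine h1.congr_of_eventuallyEq ?_
  filter_upwards [(trivializationAt (EuclideanSpace ℂ (Fin n)) E b).open_baseSet.mem_nhds hb,
    (trivializationAt (EuclideanSpace ℂ (Fin n)) E b').open_baseSet.mem_nhds hb'] with x hx hx'
  ext1 v
  simp only [toMat, Function.comp_apply, ContinuousLinearMap.comp_apply,
    ContinuousLinearEquiv.coe_coe, coordChangeL_eq hx hx', coordChangeL_eq hx' hx,
    Trivialization.symmL_continuousLinearMapAt _ hx]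

theorem contMDiffAt_toMat {S : ∀ x, E x →L[ℂ] E x} (hS : IsSmoothEnd (d := d) n S) {b x₀ : M}
    (hb : x₀ ∈ trivSet n E b) :
    ContMDiffAt (𝓡 d) 𝓘(ℝ, EuclideanSpace ℂ (Fin n) →L[ℂ] EuclideanSpace ℂ (Fin n)) ∞
      (fun x => toMat n b x (S x)) x₀ :=
  contMDiffAt_toMat_change (FiberBundle.mem_baseSet_trivializationAt' x₀) hb
    ((isSmoothEnd_iff n S).1 hS x₀)

theorem isSmoothEnd_of_toMat {S : ∀ x, E x →L[ℂ] E x} (hS : ∀ x₀, ∃ b, x₀ ∈ trivSet n E b ∧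
    ContMDiffAt (𝓡 d) 𝓘(ℝ, EuclideanSpace ℂ (Fin n) →L[ℂ] EuclideanSpace ℂ (Fin n)) ∞
      (fun x => toMat n b x (S x)) x₀) : IsSmoothEnd (d := d) n S := by
  refine (isSmoothEnd_iff n S).2 fun x₀ => ?_
  obtain ⟨b, hb, h⟩ := hS x₀
  exact contMDiffAt_toMat_change hb (FiberBundle.mem_baseSet_trivializationAt' x₀) h

end Bundle

/-- Endomorphisms of the typical fibre `ℂⁿ`. -/
abbrev Mat (n : ℕ) := EuclideanSpace ℂ (Fin n) →L[ℂ] EuclideanSpace ℂ (Fin n)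

section Mat

variable {n : ℕ}

/-- The matrix units. -/
def matUnit (i j : Fin n) : Mat n :=
  (EuclideanSpace.proj j : EuclideanSpace ℂ (Fin n) →L[ℂ] ℂ).smulRight (EuclideanSpace.single i 1)

theorem matUnit_apply (i j : Fin n) (v : EuclideanSpace ℂ (Fin n)) :
    matUnit i j v = v j • EuclideanSpace.single i (1 : ℂ) := rfl

theorem matUnit_mul (i j k l : Fin n) :
    matUnit i j * matUnit k l = if j = k then matUnit i l else 0 := by
  ext1 v
  change matUnit i j (matUnit k l v) = _
  rw [matUnit_apply, matUnit_apply]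
  split_ifs with h
  · subst h
    simp [matUnit_apply]
  · simp [h]

theorem sum_matUnit : ∑ i : Fin n, matUnit i i = 1 := by
  ext v i
  simp [matUnit_apply, Pi.single_apply]

/-- The entries of an endomorphism of `ℂⁿ`. -/
def matEntry (j k : Fin n) : Mat n →L[ℂ] ℂ :=
  (EuclideanSpace.proj j : EuclideanSpace ℂ (Fin n) →L[ℂ] ℂ).comp
    (ContinuousLinearMap.apply ℂ _ (EuclideanSpace.single k (1 : ℂ)))

theorem sum_matEntry (B : Mat n) : ∑ j, ∑ k, matEntry j k B • matUnit j k = B := by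
  ext v i
  have hv : v = ∑ k, v k • EuclideanSpace.single k (1 : ℂ) := by
    ext k
    simp [Pi.single_apply]
  conv_rhs => rw [hv]
  simp [matUnit_apply, matEntry, Pi.single_apply, mul_comm]

theorem sum_matUnit_mul_mul (l m : Fin n) (B : Mat n) :
    ∑ r, matUnit r l * B * matUnit m r = matEntry l m B • 1 := by
  have h : ∀ r, matUnit r l * B * matUnit m r = matEntry l m B • matUnit r r := fun r => by
    ext1 v
    change matUnit r l (B (matUnit m r v)) = matEntry l m B • matUnit r r v
    simp [matUnit_apply, matEntry, smul_smul, mul_comm]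
  simp only [h, ← Finset.smul_sum, sum_matUnit]

end Mat

section Smooth

open Filter Topology

variable {d : ℕ} {M : Type*} [TopologicalSpace M] [ChartedSpace (EuclideanSpace ℝ (Fin d)) M]
  {V : Type*} [NormedAddCommGroup V] [NormedSpace ℝ V] [NormedSpace ℂ V] [IsScalarTower ℝ ℂ V]

theorem ContMDiffAt.complex_smul {f : M → ℂ} {g : M → V} {x : M}
    (hf : ContMDiffAt (𝓡 d) 𝓘(ℝ, ℂ) ∞ f x) (hg : ContMDiffAt (𝓡 d) 𝓘(ℝ, V) ∞ g x) :
    ContMDiffAt (𝓡 d) 𝓘(ℝ, V) ∞ (fun y => f y • g y) x :=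
  ((isBoundedBilinearMap_smul (𝕜 := ℝ) (A := ℂ) (E := V)).contDiff.contMDiff.contMDiffAt).comp x
    (hf.prodMk_space hg)

variable [IsManifold (𝓡 d) ∞ M]

theorem contDiffAt_comp_chart_symm {V : Type*} [NormedAddCommGroup V] [NormedSpace ℝ V]
    {h : M → V} {b x : M} (hx : x ∈ (chartAt (EuclideanSpace ℝ (Fin d)) b).source)
    (hh : ContMDiffAt (𝓡 d) 𝓘(ℝ, V) ∞ h x) :
    ContDiffAt ℝ ∞ (h ∘ (chartAt (EuclideanSpace ℝ (Fin d)) b).symm)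
      (chartAt (EuclideanSpace ℝ (Fin d)) b x) := by
  rw [← contMDiffAt_iff_contDiffAt]
  set φ := chartAt (EuclideanSpace ℝ (Fin d)) b
  have h1 : ContMDiffAt (𝓡 d) (𝓡 d) ∞ φ.symm (φ x) :=
    (contMDiffOn_chart_symm (x := b)).contMDiffAt (φ.open_target.mem_nhds (φ.map_source hx))
  exact ContMDiffAt.comp (φ x) (by rwa [φ.left_inv hx]) h1

/-- The derivative of a function on `M` in the charts at the points `c x`. -/
def chartDeriv {V : Type*} [NormedAddCommGroup V] [NormedSpace ℝ V] (c : M → M) (h : M → V)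
    (x : M) : EuclideanSpace ℝ (Fin d) →L[ℝ] V :=
  fderiv ℝ (h ∘ (chartAt (EuclideanSpace ℝ (Fin d)) (c x)).symm)
    (chartAt (EuclideanSpace ℝ (Fin d)) (c x) x)

theorem chartDeriv_congr {V : Type*} [NormedAddCommGroup V] [NormedSpace ℝ V] {c : M → M}
    {h h' : M → V} {x : M} (hx : x ∈ (chartAt (EuclideanSpace ℝ (Fin d)) (c x)).source)
    (hh : ∀ᶠ y in 𝓝 x, h y = h' y) : chartDeriv (d := d) c h x = chartDeriv c h' x := by
  refine Filter.EventuallyEq.fderiv_eq ?_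
  set φ := chartAt (EuclideanSpace ℝ (Fin d)) (c x)
  have h1 : Tendsto φ.symm (𝓝 (φ x)) (𝓝 x) := by
    have := φ.symm.continuousAt (x := φ x) (φ.map_source hx)
    rwa [ContinuousAt, φ.left_inv hx] at this
  exact h1.eventually hh

theorem contMDiffAt_chartDeriv {V : Type*} [NormedAddCommGroup V] [NormedSpace ℝ V] {c : M → M}
    {h : M → V} {x : M} (hx : x ∈ (chartAt (EuclideanSpace ℝ (Fin d)) (c x)).source)
    (hc : ∀ᶠ y in 𝓝 x, c y = c x) (hh : ContMDiffAt (𝓡 d) 𝓘(ℝ, V) ∞ h x)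
    (v : EuclideanSpace ℝ (Fin d)) :
    ContMDiffAt (𝓡 d) 𝓘(ℝ, V) ∞ (fun y => chartDeriv (d := d) c h y v) x := by
  have h1 := ((contDiffAt_comp_chart_symm hx hh).fderiv_right (m := ∞) (by simp)).clm_apply
    (contDiffAt_const (c := v))
  have h2 : ContMDiffAt (𝓡 d) (𝓡 d) ∞ (chartAt (EuclideanSpace ℝ (Fin d)) (c x)) x :=
    (contMDiffOn_chart (x := c x)).contMDiffAt
      ((chartAt (EuclideanSpace ℝ (Fin d)) (c x)).open_source.mem_nhds hx)
  refine (h1.contMDiffAt.comp x h2).congr_of_eventuallyEq ?_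
  filter_upwards [hc] with y hy
  simp only [chartDeriv, hy, Function.comp_apply]

end Smooth

section Sections

open Bundle Filter Topology

variable {d n : ℕ} {M : Type*} [TopologicalSpace M]
  [ChartedSpace (EuclideanSpace ℝ (Fin d)) M] [IsManifold (𝓡 d) ∞ M]
  {E : M → Type*} [∀ x, AddCommGroup (E x)] [∀ x, Module ℂ (E x)]
  [∀ x, TopologicalSpace (E x)] [∀ x, IsTopologicalAddGroup (E x)] [∀ x, ContinuousSMul ℂ (E x)]
  [TopologicalSpace (TotalSpace (EuclideanSpace ℂ (Fin n)) E)]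
  [FiberBundle (EuclideanSpace ℂ (Fin n)) E] [VectorBundle ℂ (EuclideanSpace ℂ (Fin n)) E]
  [ContMDiffVectorBundle ∞ (EuclideanSpace ℂ (Fin n)) E (𝓡 d)]

variable (d n E) in
/-- The map `c` is locally constant around `x`, and `E` is trivialized at `c x` and `M` has the
chart at `c x` around `x`. -/
structure IsCentred (c : M → M) (x : M) : Prop where
  mem_triv : x ∈ trivSet n E (c x)
  mem_chart : x ∈ (chartAt (EuclideanSpace ℝ (Fin d)) (c x)).source
  locConst : ∀ᶠ y in 𝓝 x, c y = c x

theorem IsCentred.eventually {c : M → M} {x : M} (hx : IsCentred d n E c x) :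
    ∀ᶠ y in 𝓝 x, IsCentred d n E c y := by
  filter_upwards [hx.locConst.eventually_nhds,
    (trivializationAt (EuclideanSpace ℂ (Fin n)) E (c x)).open_baseSet.mem_nhds hx.mem_triv,
    (chartAt (EuclideanSpace ℝ (Fin d)) (c x)).open_source.mem_nhds hx.mem_chart] with y h1 h2 h3
  have := h1.self_of_nhds
  refine ⟨by rwa [trivSet, this], by rwa [this], ?_⟩
  filter_upwards [h1] with z hz
  rw [hz, this]

variable (d n E) in
/-- Around every point the function vanishes, or it is smooth and `c` is centred. -/
def IsCentredSmooth {V : Type*} [NormedAddCommGroup V] [NormedSpace ℝ V] (c : M → M)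
    (B : M → V) : Prop :=
  ∀ x, (∀ᶠ y in 𝓝 x, B y = 0) ∨ IsCentred d n E c x ∧ ContMDiffAt (𝓡 d) 𝓘(ℝ, V) ∞ B x

theorem IsCentredSmooth.contMDiff {V : Type*} [NormedAddCommGroup V] [NormedSpace ℝ V] {c : M → M}
    {B : M → V} (hB : IsCentredSmooth d n E c B) : ContMDiff (𝓡 d) 𝓘(ℝ, V) ∞ B := fun x =>
  (hB x).elim (fun h => contMDiffAt_const.congr_of_eventuallyEq h) fun h => h.2

theorem IsCentredSmooth.smul {V : Type*} [NormedAddCommGroup V] [NormedSpace ℝ V]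
    [NormedSpace ℂ V] [IsScalarTower ℝ ℂ V] {c : M → M} {f : M → ℂ}
    (hf : IsCentredSmooth d n E c f) {B : M → V}
    (hB : ∀ x, IsCentred d n E c x → ContMDiffAt (𝓡 d) 𝓘(ℝ, V) ∞ B x) :
    IsCentredSmooth d n E c fun x => f x • B x := fun x => by
  rcases hf x with h | ⟨h, h'⟩
  · left
    filter_upwards [h] with y hy
    rw [hy, zero_smul]
  · exact .inr ⟨h, ContMDiffAt.complex_smul h' (hB x h)⟩

/-- The section of `End E` given by a matrix-valued function in the trivializations at `c x`. -/
def matSection (c : M → M) (B : M → Mat n) (hB : IsCentredSmooth d n E c B) :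
    EndSec (d := d) n E :=
  ⟨fun x => ofMat E (c x) x (B x), by
    refine isSmoothEnd_of_toMat fun x => ?_
    rcases hB x with h | ⟨h, h'⟩
    · refine ⟨x, FiberBundle.mem_baseSet_trivializationAt' x,
        (contMDiffAt_const (c := (0 : Mat n))).congr_of_eventuallyEq ?_⟩
      filter_upwards [h] with y hy
      rw [hy]
      ext1 v
      simp [ofMat, toMat]
    · refine ⟨c x, h.mem_triv, h'.congr_of_eventuallyEq ?_⟩
      filter_upwards [h.eventually, h.locConst] with y hy hy'
      rw [← hy', toMat_ofMat hy.mem_triv]⟩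

/-- The matrices of a section of `End E` in the trivializations at `c x`. -/
def matOf (c : M → M) (a : EndSec (d := d) n E) (x : M) : Mat n := toMat n (c x) x (a.1 x)

theorem contMDiffAt_matOf {c : M → M} (a : EndSec (d := d) n E) {x : M}
    (hx : IsCentred d n E c x) : ContMDiffAt (𝓡 d) 𝓘(ℝ, Mat n) ∞ (matOf c a) x := by
  refine (contMDiffAt_toMat a.2 hx.mem_triv).congr_of_eventuallyEq ?_
  filter_upwards [hx.locConst] with y hy
  rw [matOf, hy]

theorem ofMat_matOf {c : M → M} (a : EndSec (d := d) n E) {x : M} (hx : IsCentred d n E c x) :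
    ofMat E (c x) x (matOf c a x) = a.1 x := ofMat_toMat hx.mem_triv _

variable (n E) in
/-- A smooth function as a section of `End E`. -/
def scalarSection (f : M → ℂ) (hf : ContMDiff (𝓡 d) 𝓘(ℝ, ℂ) ∞ f) : EndSec (d := d) n E :=
  ⟨fun x => f x • 1, by
    refine isSmoothEnd_of_toMat fun x => ⟨x, FiberBundle.mem_baseSet_trivializationAt' x, ?_⟩
    refine (ContMDiffAt.complex_smul (hf x)
      (contMDiffAt_const (c := (1 : Mat n)))).congr_of_eventuallyEq ?_
    filter_upwards [(trivializationAt (EuclideanSpace ℂ (Fin n)) E x).open_baseSet.mem_nhds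
      (FiberBundle.mem_baseSet_trivializationAt' x)] with y hy
    rw [toMat_smul, ← ofMat_one hy, toMat_ofMat hy]⟩

theorem mem_center_of_forall_smul_one {s : EndSec (d := d) n E}
    (hs : ∀ x, ∃ z : ℂ, s.1 x = z • 1) :
    s ∈ Subalgebra.center ℂ (EndSec (d := d) n E) := by
  rw [Subalgebra.mem_center_iff]
  intro a
  refine Subtype.ext (funext fun x => ?_)
  obtain ⟨z, hz⟩ := hs x
  change a.1 x * s.1 x = s.1 x * a.1 x
  rw [hz, mul_smul_comm, smul_mul_assoc, one_mul, mul_one]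

theorem scalarSection_mem_center (f : M → ℂ) (hf : ContMDiff (𝓡 d) 𝓘(ℝ, ℂ) ∞ f) :
    scalarSection n E f hf ∈ Subalgebra.center ℂ (EndSec (d := d) n E) :=
  mem_center_of_forall_smul_one fun x => ⟨f x, rfl⟩

variable [T2Space M]

/-- Derivations are local. -/
theorem Der.apply_eq_zero_of_eventually (X : Der (EndSec (d := d) n E)) {a : EndSec (d := d) n E}
    {x : M} (ha : ∀ᶠ y in 𝓝 x, a.1 y = 0) : (X a).1 x = 0 := by
  obtain ⟨f, -, hf⟩ := (SmoothBumpFunction.nhds_basis_tsupport (I := 𝓡 d) x).mem_iff.1 ha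
  have hfs : ContMDiff (𝓡 d) 𝓘(ℝ, ℂ) ∞ fun y => (f y : ℂ) :=
    Complex.ofRealCLM.contDiff.contMDiff.comp f.contMDiff
  have h0 : scalarSection n E _ hfs * a = 0 := by
    refine Subtype.ext (funext fun y => ?_)
    change (f y : ℂ) • 1 * a.1 y = 0
    by_cases hy : y ∈ tsupport f
    · rw [show a.1 y = 0 from hf hy, mul_zero]
    · rw [image_eq_zero_of_notMem_tsupport hy, Complex.ofReal_zero, zero_smul, zero_mul]
  have h1 := congrArg X h0
  rw [Der.leibniz, X.1.map_zero] at h1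
  have h2 : (X (scalarSection n E _ hfs)).1 x * a.1 x + ((f x : ℂ) • 1) * (X a).1 x = 0 :=
    congrFun (congrArg Subtype.val h1) x
  rwa [ha.self_of_nhds, mul_zero, zero_add, f.eq_one, Complex.ofReal_one, one_smul, one_mul] at h2

theorem Der.apply_congr (X : Der (EndSec (d := d) n E)) {a b : EndSec (d := d) n E}
    {x : M} (h : ∀ᶠ y in 𝓝 x, a.1 y = b.1 y) : (X a).1 x = (X b).1 x := by
  have : (X (a - b)).1 x = 0 := by
    refine Der.apply_eq_zero_of_eventually X ?_
    filter_upwards [h] with y hy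
    change a.1 y - b.1 y = 0
    rw [hy, sub_self]
  rw [map_sub] at this
  exact sub_eq_zero.1 this

end Sections

section MatrixUnits

variable {R ι : Type*} [Ring R] [Fintype ι] [DecidableEq ι] {U : ι → ι → R}

theorem derivation_matrixUnits_eq_commutator
    (hU : ∀ i j k l, U i j * U k l = if j = k then U i l else 0) (h1 : ∑ i, U i i = 1)
    {D : ι → ι → R} (hD : ∀ i j k l, D i j * U k l + U i j * D k l = if j = k then D i l else 0)
    (o j k : ι) :
    D j k = (∑ i, D i o * U o i) * U j k - U j k * ∑ i, D i o * U o i := by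
  have e1 : (∑ i, D i o * U o i) * U j k = D j o * U o k := by
    simp [Finset.sum_mul, mul_assoc, hU]
  have e2 : ∀ i, U j k * (D i o * U o i) = (if k = i then D j o * U o i else 0) - D j k * U i i := by
    intro i
    rw [← mul_assoc, eq_sub_of_add_eq' (hD j k i o), sub_mul, mul_assoc, hU, if_pos rfl]
    split_ifs <;> simp
  rw [e1, Finset.mul_sum, Finset.sum_congr rfl fun i _ => e2 i, Finset.sum_sub_distrib,
    ← Finset.mul_sum, h1]
  simp

theorem sum_matrixUnits_expansion
    (hU : ∀ i j k l, U i j * U k l = if j = k then U i l else 0) (h1 : ∑ i, U i i = 1) (B : R) :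
    ∑ l, ∑ m, (∑ r, U r l * B * U m r) * U l m = B := by
  have e : ∀ l m, (∑ r, U r l * B * U m r) * U l m = U l l * B * U m m := fun l m => by
    simp [Finset.sum_mul, mul_assoc, hU]
  simp only [e, ← Finset.mul_sum, h1, mul_one, ← Finset.sum_mul, one_mul]

end MatrixUnits

theorem Der.apply_one {A : Type*} [Ring A] [Algebra ℂ A] (X : Der A) : X (1 : A) = 0 := by
  have := Der.leibniz X 1 1
  simpa using this

section Patch

open Bundle Filter Topology

variable {d n : ℕ} {M : Type*} [TopologicalSpace M]
  [ChartedSpace (EuclideanSpace ℝ (Fin d)) M] [IsManifold (𝓡 d) ∞ M]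
  {E : M → Type*} [∀ x, AddCommGroup (E x)] [∀ x, Module ℂ (E x)]
  [∀ x, TopologicalSpace (E x)] [∀ x, IsTopologicalAddGroup (E x)] [∀ x, ContinuousSMul ℂ (E x)]
  [TopologicalSpace (TotalSpace (EuclideanSpace ℂ (Fin n)) E)]
  [FiberBundle (EuclideanSpace ℂ (Fin n)) E] [VectorBundle ℂ (EuclideanSpace ℂ (Fin n)) E]
  [ContMDiffVectorBundle ∞ (EuclideanSpace ℂ (Fin n)) E (𝓡 d)]

/-- The value of a section of `End E` at a point. -/
def evalAt (x : M) : EndSec (d := d) n E →ₐ[ℂ] (E x →L[ℂ] E x) :=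
  (Pi.evalAlgHom ℂ (fun x => E x →L[ℂ] E x) x).comp (Subalgebra.val _)

theorem EndSec.ext_evalAt {a b : EndSec (d := d) n E} (h : ∀ x, evalAt x a = evalAt x b) : a = b :=
  Subtype.ext (funext h)

/-- The `μ`-th coordinate in the charts at the points `c x`. -/
def coordFun (c : M → M) (μ : Fin d) (x : M) : ℂ :=
  ((chartAt (EuclideanSpace ℝ (Fin d)) (c x) x μ : ℝ) : ℂ)

theorem contMDiffAt_comp_chart {V : Type*} [NormedAddCommGroup V] [NormedSpace ℝ V] {c : M → M}
    {x : M} (hx : IsCentred d n E c x) {g : EuclideanSpace ℝ (Fin d) → V} (hg : ContDiff ℝ ∞ g) :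
    ContMDiffAt (𝓡 d) 𝓘(ℝ, V) ∞ (fun y => g (chartAt (EuclideanSpace ℝ (Fin d)) (c y) y)) x := by
  have h2 : ContMDiffAt (𝓡 d) (𝓡 d) ∞ (chartAt (EuclideanSpace ℝ (Fin d)) (c x)) x :=
    (contMDiffOn_chart (x := c x)).contMDiffAt
      ((chartAt (EuclideanSpace ℝ (Fin d)) (c x)).open_source.mem_nhds hx.mem_chart)
  refine (hg.contMDiff.contMDiffAt.comp x h2).congr_of_eventuallyEq ?_
  filter_upwards [hx.locConst] with y hy
  rw [Function.comp_apply, hy]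

theorem contMDiffAt_coordFun {c : M → M} {x : M} (hx : IsCentred d n E c x) (μ : Fin d) :
    ContMDiffAt (𝓡 d) 𝓘(ℝ, ℂ) ∞ (coordFun c μ) x :=
  contMDiffAt_comp_chart hx (g := fun q => ((q μ : ℝ) : ℂ))
    (Complex.ofRealCLM.contDiff.comp
      (EuclideanSpace.proj μ : EuclideanSpace ℝ (Fin d) →L[ℝ] ℝ).contDiff)

variable {c : M → M} {χ : M → ℂ} (hχ : IsCentredSmooth d n E c χ)

/-- The coordinate functions, cut off by `χ`, as central sections of `End E`. -/
def coordSection (μ : Fin d) : EndSec (d := d) n E :=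
  scalarSection n E _ (hχ.smul fun _ hx => contMDiffAt_coordFun hx μ).contMDiff

/-- The matrix units in the trivializations at `c x`, cut off by `χ`. -/
def unitSection (i j : Fin n) : EndSec (d := d) n E :=
  matSection c _ (hχ.smul fun _ _ => contMDiffAt_const (c := matUnit i j))

theorem unitSection_apply (i j : Fin n) (x : M) :
    evalAt x (unitSection hχ i j) = χ x • ofMat E (c x) x (matUnit i j) := ofMat_smul _ _ _ _

variable [T2Space M]

/-- The action of a derivation on scalar functions. -/
theorem Der.apply_scalarSection (X : Der (EndSec (d := d) n E)) {f : M → ℂ}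
    (hf : ContMDiff (𝓡 d) 𝓘(ℝ, ℂ) ∞ f) {x : M} (hx : IsCentred d n E c x)
    (h1 : ∀ᶠ y in 𝓝 x, χ y = 1) :
    evalAt x (X (scalarSection n E f hf)) =
      ∑ μ, chartDeriv c f x (EuclideanSpace.single μ 1) • evalAt x (X (coordSection hχ μ)) := by
  set φ := chartAt (EuclideanSpace ℝ (Fin d)) (c x) with hφ
  have hdiff : ContDiffOn ℝ ∞ (f ∘ φ.symm) φ.target := by
    rw [← contMDiffOn_iff_contDiffOn]
    exact hf.comp_contMDiffOn (contMDiffOn_chart_symm (x := c x))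
  obtain ⟨G, hG, hs, hd⟩ := exists_contDiff_eventually_eq_add_sum φ.open_target hdiff
    (φ.map_source hx.mem_chart)
  have hg : ∀ μ, ContMDiff (𝓡 d) 𝓘(ℝ, ℂ) ∞ fun y =>
      χ y • G μ (chartAt (EuclideanSpace ℝ (Fin d)) (c y) y) := fun μ =>
    (hχ.smul fun _ hx => contMDiffAt_comp_chart hx (hG μ)).contMDiff
  let b : EndSec (d := d) n E := f x • (1 : EndSec (d := d) n E) +
    ∑ μ, (coordSection hχ μ - coordFun c μ x • (1 : EndSec (d := d) n E)) *
      scalarSection n E _ (hg μ)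
  have hchart : Tendsto φ (𝓝 x) (𝓝 (φ x)) := φ.continuousAt hx.mem_chart
  have hgerm : ∀ᶠ y in 𝓝 x, (scalarSection n E f hf).1 y = b.1 y := by
    filter_upwards [hchart.eventually hs, h1, hx.locConst,
      φ.open_source.mem_nhds hx.mem_chart] with y hy hy1 hyc hys
    change f y • (1 : E y →L[ℂ] E y) = evalAt y b
    simp only [Function.comp_apply, φ.left_inv hys, φ.left_inv hx.mem_chart] at hy
    have e1 : ∀ μ, evalAt y (coordSection hχ μ) = ((φ y μ : ℝ) : ℂ) • 1 := fun μ => by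
      change (χ y • coordFun c μ y) • (1 : E y →L[ℂ] E y) = _
      rw [hy1, one_smul, coordFun, hyc]
    have e2 : ∀ μ, evalAt y (scalarSection n E _ (hg μ)) = G μ (φ y) • 1 := fun μ => by
      change (χ y • G μ _) • (1 : E y →L[ℂ] E y) = _
      rw [hy1, one_smul, hyc]
    simp only [b, map_add, map_sum, map_mul, map_sub, map_smul, map_one, e1, e2]
    rw [hy, add_smul, Finset.sum_smul]
    congr 1
    refine Finset.sum_congr rfl fun μ _ => ?_
    rw [← sub_smul, smul_mul_smul_comm, mul_one, Complex.ofReal_sub]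
    rfl
  have hX : evalAt x (X (scalarSection n E f hf)) = evalAt x (X b) := Der.apply_congr X hgerm
  rw [hX]
  have e0 : X b = ∑ μ, (X (coordSection hχ μ) * scalarSection n E _ (hg μ) +
      (coordSection hχ μ - coordFun c μ x • (1 : EndSec (d := d) n E)) *
        X (scalarSection n E _ (hg μ))) := by
    have hone : X.1 (1 : EndSec (d := d) n E) = 0 := Der.apply_one X
    simp only [b, map_add, map_sum, map_smul, hone, smul_zero, zero_add]
    refine Finset.sum_congr rfl fun μ _ => ?_
    rw [Der.leibniz, map_sub, map_smul, hone, smul_zero, sub_zero]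
  rw [e0, map_sum]
  refine Finset.sum_congr rfl fun μ _ => ?_
  have e1 : evalAt x (coordSection hχ μ) = coordFun c μ x • 1 := by
    change (χ x • coordFun c μ x) • (1 : E x →L[ℂ] E x) = _
    rw [h1.self_of_nhds, one_smul]
  have e2 : evalAt x (scalarSection n E _ (hg μ)) = G μ (φ x) • 1 := by
    change (χ x • G μ _) • (1 : E x →L[ℂ] E x) = _
    rw [h1.self_of_nhds, one_smul]
  rw [map_add, map_mul, map_mul, map_sub, map_smul, map_one, e1, sub_self, zero_mul, add_zero, e2,
    mul_smul_comm, mul_one, hd μ]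
  rfl

end Patch

section Derivative

variable {d n : ℕ} {M : Type*} [TopologicalSpace M]
  [ChartedSpace (EuclideanSpace ℝ (Fin d)) M] [IsManifold (𝓡 d) ∞ M] {c : M → M} {x : M}

theorem chartDeriv_clm_comp {V W : Type*} [NormedAddCommGroup V] [NormedSpace ℝ V]
    [NormedAddCommGroup W] [NormedSpace ℝ W] (L : V →L[ℝ] W) {h : M → V}
    (hx : x ∈ (chartAt (EuclideanSpace ℝ (Fin d)) (c x)).source)
    (hh : ContMDiffAt (𝓡 d) 𝓘(ℝ, V) ∞ h x) (v : EuclideanSpace ℝ (Fin d)) :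
    chartDeriv c (fun y => L (h y)) x v = L (chartDeriv c h x v) := by
  have h1 := ((contDiffAt_comp_chart_symm hx hh).differentiableAt (by simp)).hasFDerivAt
  exact congrArg (fun T => T v) (L.hasFDerivAt.comp _ h1).fderiv

theorem chartDeriv_add {V : Type*} [NormedAddCommGroup V] [NormedSpace ℝ V] {g h : M → V}
    (hx : x ∈ (chartAt (EuclideanSpace ℝ (Fin d)) (c x)).source)
    (hg : ContMDiffAt (𝓡 d) 𝓘(ℝ, V) ∞ g x)
    (hh : ContMDiffAt (𝓡 d) 𝓘(ℝ, V) ∞ h x) (v : EuclideanSpace ℝ (Fin d)) :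
    chartDeriv c (fun y => g y + h y) x v = chartDeriv c g x v + chartDeriv c h x v := by
  have h1 := ((contDiffAt_comp_chart_symm hx hg).differentiableAt (by simp)).hasFDerivAt
  have h2 := ((contDiffAt_comp_chart_symm hx hh).differentiableAt (by simp)).hasFDerivAt
  exact congrArg (fun T => T v) (h1.add h2).fderiv

theorem isBoundedBilinearMap_mat_mul :
    IsBoundedBilinearMap ℝ fun f : Mat n × Mat n => f.1 * f.2 where
  add_left f g h := add_mul f g h
  smul_left r f g := by ext1 v; rfl
  add_right f g h := mul_add f g h
  smul_right r f g := by
    ext1 v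
    exact map_smul f (r : ℂ) (g v)
  bound := ⟨1, one_pos, fun f g => by
    rw [one_mul]
    exact norm_mul_le f g⟩

theorem chartDeriv_mul {g h : M → Mat n}
    (hx : x ∈ (chartAt (EuclideanSpace ℝ (Fin d)) (c x)).source)
    (hg : ContMDiffAt (𝓡 d) 𝓘(ℝ, Mat n) ∞ g x)
    (hh : ContMDiffAt (𝓡 d) 𝓘(ℝ, Mat n) ∞ h x) (v : EuclideanSpace ℝ (Fin d)) :
    chartDeriv c (fun y => g y * h y) x v =
      chartDeriv c g x v * h x + g x * chartDeriv c h x v := by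
  have h1 := ((contDiffAt_comp_chart_symm hx hg).differentiableAt (by simp)).hasFDerivAt
  have h2 := ((contDiffAt_comp_chart_symm hx hh).differentiableAt (by simp)).hasFDerivAt
  have h3 := congrArg (fun T => T v)
    ((isBoundedBilinearMap_mat_mul.hasFDerivAt _).comp _ (h1.prodMk h2)).fderiv
  refine h3.trans ?_
  simp [(chartAt (EuclideanSpace ℝ (Fin d)) (c x)).left_inv hx, chartDeriv, add_comm]

end Derivative

theorem Der.sum_apply {A κ : Type*} [Ring A] [Algebra ℂ A] (s : Finset κ) (X : κ → Der A) (a : A) :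
    (∑ k ∈ s, X k : Der A) a = ∑ k ∈ s, X k a := by
  rw [Submodule.coe_sum, LinearMap.sum_apply]

/-- The inner derivation `a ↦ b * a - a * b`. -/
def innerDer {A : Type*} [Ring A] [Algebra ℂ A] (b : A) : Der A :=
  ⟨LinearMap.mulLeft ℂ b - LinearMap.mulRight ℂ b, fun x y => by
    simp only [LinearMap.sub_apply, LinearMap.mulLeft_apply, LinearMap.mulRight_apply]
    noncomm_ring⟩

theorem innerDer_apply {A : Type*} [Ring A] [Algebra ℂ A] (a b : A) :
    innerDer b a = b * a - a * b := rfl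

section Patch

open Bundle Filter Topology

variable {d n : ℕ} {M : Type*} [TopologicalSpace M]
  [ChartedSpace (EuclideanSpace ℝ (Fin d)) M] [IsManifold (𝓡 d) ∞ M]
  {E : M → Type*} [∀ x, AddCommGroup (E x)] [∀ x, Module ℂ (E x)]
  [∀ x, TopologicalSpace (E x)] [∀ x, IsTopologicalAddGroup (E x)] [∀ x, ContinuousSMul ℂ (E x)]
  [TopologicalSpace (TotalSpace (EuclideanSpace ℂ (Fin n)) E)]
  [FiberBundle (EuclideanSpace ℂ (Fin n)) E] [VectorBundle ℂ (EuclideanSpace ℂ (Fin n)) E]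
  [ContMDiffVectorBundle ∞ (EuclideanSpace ℂ (Fin n)) E (𝓡 d)]
  {c : M → M} {ρ χ : M → ℂ}

/-- The values of `partialDer`. -/
def partialSection (hρ : IsCentredSmooth d n E c ρ) (v : EuclideanSpace ℝ (Fin d))
    (a : EndSec (d := d) n E) : EndSec (d := d) n E :=
  matSection c _ (hρ.smul fun _ hx =>
    contMDiffAt_chartDeriv hx.mem_chart hx.locConst (contMDiffAt_matOf a hx) v)

theorem evalAt_partialSection (hρ : IsCentredSmooth d n E c ρ) (v : EuclideanSpace ℝ (Fin d))
    (a : EndSec (d := d) n E) (x : M) : evalAt x (partialSection hρ v a) =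
      ρ x • ofMat E (c x) x (chartDeriv c (matOf c a) x v) := ofMat_smul _ _ _ _

/-- The derivative of sections of `End E` in a fixed direction of the charts at the points `c x`,
cut off by `ρ`. -/
def partialDer (hρ : IsCentredSmooth d n E c ρ) (v : EuclideanSpace ℝ (Fin d)) :
    Der (EndSec (d := d) n E) := by
  have hx : ∀ x, ρ x ≠ 0 → IsCentred d n E c x := fun x h =>
    ((hρ x).resolve_left fun h' => h h'.self_of_nhds).1
  refine ⟨⟨⟨partialSection hρ v, fun a b => EndSec.ext_evalAt fun x => ?_⟩,
    fun z a => EndSec.ext_evalAt fun x => ?_⟩, fun a b => EndSec.ext_evalAt fun x => ?_⟩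
  · rw [map_add]
    simp only [evalAt_partialSection]
    by_cases h : ρ x = 0
    · simp [h]
    have h1 : matOf c (a + b) = fun y => matOf c a y + matOf c b y :=
      funext fun y => toMat_add _ _ _ _
    rw [h1, chartDeriv_add (hx x h).mem_chart (contMDiffAt_matOf a (hx x h))
      (contMDiffAt_matOf b (hx x h)), ofMat_add, smul_add]
  · rw [map_smul]
    simp only [evalAt_partialSection]
    by_cases h : ρ x = 0
    · simp [h]
    have h1 : matOf c (z • a) = fun y =>
        ((z • ContinuousLinearMap.id ℂ (Mat n)).restrictScalars ℝ) (matOf c a y) :=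
      funext fun y => toMat_smul _ _ _ _
    rw [h1, chartDeriv_clm_comp _ (hx x h).mem_chart (contMDiffAt_matOf a (hx x h))]
    change ρ x • ofMat E (c x) x (z • _) = z • ρ x • _
    rw [ofMat_smul, smul_comm]
    rfl
  · change evalAt x (partialSection hρ v (a * b)) =
      evalAt x (partialSection hρ v a * b + a * partialSection hρ v b)
    rw [map_add, map_mul, map_mul]
    simp only [evalAt_partialSection]
    by_cases h : ρ x = 0
    · simp [h]
    have h1 : ∀ᶠ y in 𝓝 x, matOf c (a * b) y = matOf c a y * matOf c b y := by
      filter_upwards [(hx x h).eventually] with y hy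
      exact toMat_mul hy.mem_triv _ _
    rw [chartDeriv_congr (hx x h).mem_chart h1, chartDeriv_mul (hx x h).mem_chart
      (contMDiffAt_matOf a (hx x h)) (contMDiffAt_matOf b (hx x h)), ofMat_add,
      ofMat_mul (hx x h).mem_triv, ofMat_mul (hx x h).mem_triv, ofMat_matOf a (hx x h),
      ofMat_matOf b (hx x h), smul_add, smul_mul_assoc, mul_smul_comm]
    rfl

theorem evalAt_partialDer (hρ : IsCentredSmooth d n E c ρ) (v : EuclideanSpace ℝ (Fin d))
    (a : EndSec (d := d) n E) (x : M) : evalAt x (partialDer hρ v a) =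
      ρ x • ofMat E (c x) x (chartDeriv c (matOf c a) x v) := evalAt_partialSection hρ v a x

variable (hχ : IsCentredSmooth d n E c χ)

theorem unitSection_mul_apply {y : M} (hy : IsCentred d n E c y) (h1 : χ y = 1) (i j k l : Fin n) :
    evalAt y (unitSection hχ i j) * evalAt y (unitSection hχ k l) =
      if j = k then evalAt y (unitSection hχ i l) else 0 := by
  simp only [unitSection_apply, h1, one_smul]
  rw [← ofMat_mul hy.mem_triv, matUnit_mul]
  split_ifs
  · rfl
  · exact (ofMatₗ E (c y) y).map_zero

theorem sum_unitSection_apply {y : M} (hy : IsCentred d n E c y) (h1 : χ y = 1) :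
    ∑ i, evalAt y (unitSection hχ i i) = 1 := by
  simp only [unitSection_apply, h1, one_smul]
  rw [← ofMat_one hy.mem_triv, ← sum_matUnit]
  exact (map_sum (ofMatₗ E (c y) y) _ _).symm

/-- The entries of sections of `End E` in the trivializations at the points `c x`, cut off, as
central sections. -/
def entrySection (l m : Fin n) (b : EndSec (d := d) n E) : EndSec (d := d) n E :=
  ∑ r, unitSection hχ r l * b * unitSection hχ m r

theorem entrySection_mem_center (l m : Fin n) (b : EndSec (d := d) n E) :
    entrySection hχ l m b ∈ Subalgebra.center ℂ (EndSec (d := d) n E) := by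
  refine mem_center_of_forall_smul_one fun x => ?_
  change ∃ z : ℂ, evalAt x (entrySection hχ l m b) = z • 1
  simp only [entrySection, map_sum, map_mul, unitSection_apply]
  rcases hχ x with h | ⟨hx, -⟩
  · exact ⟨0, by simp [h.self_of_nhds]⟩
  · refine ⟨χ x * χ x * matEntry l m (matOf c b x), ?_⟩
    have hb : evalAt x b = ofMat E (c x) x (matOf c b x) := (ofMat_matOf b hx).symm
    have h2 : ∀ r, χ x • ofMat E (c x) x (matUnit r l) * evalAt x b *
        χ x • ofMat E (c x) x (matUnit m r) = (χ x * χ x) • ofMatₗ E (c x) x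
          (matUnit r l * matOf c b x * matUnit m r) := fun r => by
      change _ = (χ x * χ x) • ofMat E (c x) x _
      rw [hb, ofMat_mul hx.mem_triv, ofMat_mul hx.mem_triv, smul_mul_assoc, smul_mul_assoc,
        mul_smul_comm, smul_smul]
    simp only [h2]
    rw [← Finset.smul_sum, ← map_sum, sum_matUnit_mul_mul, map_smul, smul_smul]
    congr 1
    exact ofMat_one hx.mem_triv

variable [T2Space M]

/-- The section whose commutator with the matrix units is a given derivation. -/
def connSection (o : Fin n) (X : Der (EndSec (d := d) n E)) : EndSec (d := d) n E :=
  ∑ i, X (unitSection hχ i o) * unitSection hχ o i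

theorem Der.apply_unitSection (X : Der (EndSec (d := d) n E)) {x : M}
    (hx : IsCentred d n E c x) (h1 : ∀ᶠ y in 𝓝 x, χ y = 1) (o j k : Fin n) :
    evalAt x (X (unitSection hχ j k)) =
      evalAt x (connSection hχ o X) * evalAt x (unitSection hχ j k) -
        evalAt x (unitSection hχ j k) * evalAt x (connSection hχ o X) := by
  simp only [connSection, map_sum, map_mul]
  refine derivation_matrixUnits_eq_commutator (unitSection_mul_apply hχ hx h1.self_of_nhds)
    (sum_unitSection_apply hχ hx h1.self_of_nhds)
    (D := fun i j => evalAt x (X (unitSection hχ i j))) (fun i j k l => ?_) o j k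
  have h2 : evalAt x (X (unitSection hχ i j * unitSection hχ k l)) =
      evalAt x (X (if j = k then unitSection hχ i l else 0)) := by
    refine Der.apply_congr X ?_
    filter_upwards [hx.eventually, h1] with y hy hy1
    change evalAt y (unitSection hχ i j * unitSection hχ k l) =
      evalAt y (if j = k then unitSection hχ i l else 0)
    rw [map_mul, unitSection_mul_apply hχ hy hy1]
    split_ifs
    · rfl
    · exact (map_zero _).symm
  rw [Der.leibniz, map_add, map_mul, map_mul] at h2
  rw [h2]
  split_ifs
  · rfl
  · rw [map_zero, map_zero]

theorem contMDiff_smul_matEntry (hχ : IsCentredSmooth d n E c χ) (j k : Fin n) (a : EndSec (d := d) n E) :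
    ContMDiff (𝓡 d) 𝓘(ℝ, ℂ) ∞ fun y => χ y • matEntry j k (matOf c a y) :=
  (hχ.smul fun _ hx => (((matEntry j k).restrictScalars ℝ).contDiff.contMDiff.contMDiffAt).comp _
    (contMDiffAt_matOf a hx)).contMDiff

/-- Near the points with `χ = 1`, a derivation is a combination of derivatives in the directions
of the coordinates and of commutators with the matrix units. -/
theorem Der.evalAt_apply (X : Der (EndSec (d := d) n E)) (a : EndSec (d := d) n E) {x : M}
    (hx : IsCentred d n E c x) (h1 : ∀ᶠ y in 𝓝 x, χ y = 1) (o : Fin n) :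
    evalAt x (X a) =
      ∑ μ, evalAt x (X (coordSection hχ μ)) *
        ofMat E (c x) x (chartDeriv c (matOf c a) x (EuclideanSpace.single μ 1)) +
      ∑ l, ∑ m, evalAt x (entrySection hχ l m (connSection hχ o X)) *
        (evalAt x (unitSection hχ l m) * evalAt x a -
          evalAt x a * evalAt x (unitSection hχ l m)) := by
  have hexp : ∀ y, IsCentred d n E c y → χ y = 1 → ∀ B : Mat n,
      ofMat E (c y) y B = ∑ j, ∑ k, matEntry j k B • evalAt y (unitSection hχ j k) := by
    intro y hy hy1 B
    simp only [unitSection_apply, hy1, one_smul]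
    conv_lhs => rw [← sum_matEntry B]
    change ofMatₗ E (c y) y _ = _
    simp only [map_sum, map_smul]
    rfl
  set A := connSection hχ o X with hA
  have hgerm : evalAt x (X a) = evalAt x (X (∑ j, ∑ k,
      scalarSection n E _ (contMDiff_smul_matEntry hχ j k a) * unitSection hχ j k)) := by
    refine Der.apply_congr X ?_
    filter_upwards [hx.eventually, h1] with y hy hy1
    change evalAt y a = evalAt y (∑ j, ∑ k,
      scalarSection n E _ (contMDiff_smul_matEntry hχ j k a) * unitSection hχ j k)
    have : evalAt y a = ofMat E (c y) y (matOf c a y) := (ofMat_matOf a hy).symm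
    rw [this, hexp y hy hy1]
    simp only [map_sum, map_mul]
    refine Finset.sum_congr rfl fun j _ => Finset.sum_congr rfl fun k _ => ?_
    change _ = ((χ y • matEntry j k (matOf c a y)) • (1 : E y →L[ℂ] E y)) * _
    rw [hy1, one_smul, smul_mul_assoc, one_mul]
  have hval : ∀ j k, evalAt x (scalarSection n E _ (contMDiff_smul_matEntry hχ j k a)) =
      matEntry j k (matOf c a x) • 1 := fun j k => by
    change (χ x • matEntry j k (matOf c a x)) • (1 : E x →L[ℂ] E x) = _
    rw [h1.self_of_nhds, one_smul]
  have hderiv : ∀ j k v, chartDeriv c (fun y => χ y • matEntry j k (matOf c a y)) x v =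
      matEntry j k (chartDeriv c (matOf c a) x v) := fun j k v => by
    have h2 : ∀ᶠ y in 𝓝 x, χ y • matEntry j k (matOf c a y) =
        (matEntry j k).restrictScalars ℝ (matOf c a y) := by
      filter_upwards [h1] with y hy
      rw [hy, one_smul]
      rfl
    rw [chartDeriv_congr hx.mem_chart h2, chartDeriv_clm_comp _ hx.mem_chart
      (contMDiffAt_matOf a hx)]
    rfl
  have hax : evalAt x a = ∑ j, ∑ k, matEntry j k (matOf c a x) • evalAt x (unitSection hχ j k) := by
    rw [← hexp x hx h1.self_of_nhds]
    exact (ofMat_matOf a hx).symm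
  have hcomm : evalAt x A * evalAt x a - evalAt x a * evalAt x A =
      ∑ l, ∑ m, evalAt x (entrySection hχ l m A) *
        (evalAt x (unitSection hχ l m) * evalAt x a -
          evalAt x a * evalAt x (unitSection hχ l m)) := by
    have h2 := sum_matrixUnits_expansion (unitSection_mul_apply hχ hx h1.self_of_nhds)
      (sum_unitSection_apply hχ hx h1.self_of_nhds) (evalAt x A)
    have h3 : ∀ l m, evalAt x (entrySection hχ l m A) =
        ∑ r, evalAt x (unitSection hχ r l) * evalAt x A * evalAt x (unitSection hχ m r) :=
      fun l m => by simp only [entrySection, map_sum, map_mul]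
    have h4 : ∀ l m, evalAt x a * evalAt x (entrySection hχ l m A) =
        evalAt x (entrySection hχ l m A) * evalAt x a := fun l m => by
      rw [← map_mul, ← map_mul, Subalgebra.mem_center_iff.1 (entrySection_mem_center hχ l m A) a]
    simp only [← h3] at h2
    conv_lhs => rw [← h2]
    simp only [Finset.sum_mul, Finset.mul_sum, ← Finset.sum_sub_distrib]
    refine Finset.sum_congr rfl fun l _ => Finset.sum_congr rfl fun m _ => ?_
    rw [mul_sub, mul_assoc, ← mul_assoc (evalAt x a), h4, mul_assoc]
  rw [hgerm, ← hcomm, hax]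
  simp only [map_sum, Der.leibniz, map_add, map_mul, hval,
    Der.apply_scalarSection hχ X (contMDiff_smul_matEntry hχ _ _ a) hx h1, hderiv,
    Der.apply_unitSection hχ X hx h1 o, hexp x hx h1.self_of_nhds, Finset.sum_add_distrib]
  congr 1
  · simp only [Finset.sum_mul, Finset.mul_sum, smul_mul_assoc, mul_smul_comm]
    conv_rhs => rw [Finset.sum_comm]
    exact Finset.sum_congr rfl fun j _ => Finset.sum_comm
  · simp only [Finset.sum_mul, Finset.mul_sum, ← Finset.sum_sub_distrib, smul_mul_assoc, one_mul,
      mul_smul_comm, smul_sub, ← hA]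

end Patch

section Expansion

open Bundle Filter Topology

variable {d n : ℕ} {M : Type*} [TopologicalSpace M]
  [ChartedSpace (EuclideanSpace ℝ (Fin d)) M] [IsManifold (𝓡 d) ∞ M] [T2Space M]
  {E : M → Type*} [∀ x, AddCommGroup (E x)] [∀ x, Module ℂ (E x)]
  [∀ x, TopologicalSpace (E x)] [∀ x, IsTopologicalAddGroup (E x)] [∀ x, ContinuousSMul ℂ (E x)]
  [TopologicalSpace (TotalSpace (EuclideanSpace ℂ (Fin n)) E)]
  [FiberBundle (EuclideanSpace ℂ (Fin n)) E] [VectorBundle ℂ (EuclideanSpace ℂ (Fin n)) E]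
  [ContMDiffVectorBundle ∞ (EuclideanSpace ℂ (Fin n)) E (𝓡 d)]

theorem entrySection_connSection_mem_oneSpan {c : M → M} {χ : M → ℂ}
    (hχ : IsCentredSmooth d n E c χ) (o l m : Fin n) :
    (fun X => entrySection hχ l m (connSection hχ o X)) ∈ oneSpan (EndSec (d := d) n E) :=
  oneSpan_sum _ fun _ _ => oneSpan_mul_right (oneSpan_mul_left
    (oneSpan_sum _ fun _ _ => oneSpan_mul_right (eval_mem_oneSpan _) _) _) _

variable (n E) in
/-- A smooth function as a central section of `End E`. -/
def centralSection (f : M → ℂ) (hf : ContMDiff (𝓡 d) 𝓘(ℝ, ℂ) ∞ f) :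
    Subalgebra.center ℂ (EndSec (d := d) n E) :=
  ⟨scalarSection n E f hf, scalarSection_mem_center f hf⟩

theorem hasDualExpansion_centralSection {c : M → M} {ρ χ : M → ℂ}
    (hρ : IsCentredSmooth d n E c ρ) (hχ : IsCentredSmooth d n E c χ)
    (h1 : ∀ x, ρ x ≠ 0 → ∀ᶠ y in 𝓝 x, χ y = 1) (o : Fin n) :
    HasDualExpansion (centralSection n E ρ hρ.contMDiff) := by
  refine ⟨Fin d ⊕ Fin n × Fin n, inferInstance,
    Sum.elim (fun μ X => Der.onCenter X ⟨coordSection hχ μ, scalarSection_mem_center _ _⟩)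
      fun p X => ⟨entrySection hχ p.1 p.2 (connSection hχ o X), entrySection_mem_center _ _ _ _⟩,
    Sum.elim (fun μ => partialDer hρ (EuclideanSpace.single μ 1))
      fun p => centralSection n E ρ hρ.contMDiff • innerDer (unitSection hχ p.1 p.2), ?_,
    fun X => Der.ext fun a => EndSec.ext_evalAt fun x => ?_⟩
  · rintro (μ | ⟨l, m⟩)
    · exact eval_mem_oneSpan _
    · exact entrySection_connSection_mem_oneSpan hχ o l m
  have hs : evalAt x (centralSection n E ρ hρ.contMDiff : EndSec (d := d) n E) = ρ x • 1 := rfl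
  rw [Der.sum_apply, map_sum]
  simp only [Fintype.sum_sum_type, Fintype.sum_prod_type, Sum.elim_inl, Sum.elim_inr,
    Der.smul_apply, map_mul, hs, evalAt_partialDer, innerDer_apply, map_sub, smul_mul_assoc,
    mul_smul_comm, one_mul, ← Finset.smul_sum, ← smul_add]
  by_cases h : ρ x = 0
  · rw [h, zero_smul, zero_smul]
  · rw [Der.evalAt_apply hχ X a ((hρ x).resolve_left fun h' => h h'.self_of_nhds).1 (h1 x h) o]
    rfl

theorem hasDualExpansion_one_of_isEmpty [IsEmpty (Fin n)] :
    HasDualExpansion (1 : Subalgebra.center ℂ (EndSec (d := d) n E)) := by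
  have hsub : Subsingleton (EndSec (d := d) n E) := ⟨fun a b => EndSec.ext_evalAt fun x => by
    have hx : x ∈ trivSet n E x := FiberBundle.mem_baseSet_trivializationAt' x
    change a.1 x = b.1 x
    rw [← ofMat_toMat hx (a.1 x), ← ofMat_toMat hx (b.1 x)]
    congr 1
    ext v i
    exact isEmptyElim i⟩
  exact ⟨Empty, inferInstance, fun i => i.elim, fun i => i.elim, fun i => i.elim,
    fun X => Der.ext fun a => Subsingleton.elim _ _⟩

theorem ColouredPartition.isCentredSmooth_χ
    (P : ColouredPartition d fun b : M =>
      trivSet n E b ∩ (chartAt (EuclideanSpace ℝ (Fin d)) b).source) (k : Fin (d + 1)) :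
    IsCentredSmooth d n E (P.c k) fun x => (P.χ k x : ℂ) := fun x => by
  rcases P.mem k x with h | ⟨h, h'⟩
  · left
    filter_upwards [h] with y hy
    rw [hy, Complex.ofReal_zero]
  · exact .inr ⟨⟨h.1, h.2, h'⟩,
      (Complex.ofRealCLM.contDiff.contMDiff.comp (P.contMDiff_χ k)).contMDiffAt⟩

theorem ColouredPartition.isCentredSmooth_ρ
    (P : ColouredPartition d fun b : M =>
      trivSet n E b ∩ (chartAt (EuclideanSpace ℝ (Fin d)) b).source) (k : Fin (d + 1)) :
    IsCentredSmooth d n E (P.c k) fun x => (P.ρ k x : ℂ) := fun x => by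
  rcases P.mem k x with h | ⟨h, h'⟩
  · left
    filter_upwards [h] with y hy
    by_contra hne
    have := (P.χ_eq_one k y (by simpa using hne)).self_of_nhds
    rw [hy] at this
    exact zero_ne_one this
  · exact .inr ⟨⟨h.1, h.2, h'⟩,
      (Complex.ofRealCLM.contDiff.contMDiff.comp (P.contMDiff_ρ k)).contMDiffAt⟩

theorem hasDualExpansion_one [ParacompactSpace M] :
    HasDualExpansion (1 : Subalgebra.center ℂ (EndSec (d := d) n E)) := by
  cases isEmpty_or_nonempty (Fin n) with
  | inl _ => exact hasDualExpansion_one_of_isEmpty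
  | inr hn =>
    obtain ⟨o⟩ := hn
    obtain ⟨P⟩ : Nonempty (ColouredPartition d fun b : M =>
        trivSet n E b ∩ (chartAt (EuclideanSpace ℝ (Fin d)) b).source) :=
      nonempty_colouredPartition fun b => inter_mem
        ((trivializationAt (EuclideanSpace ℂ (Fin n)) E b).open_baseSet.mem_nhds
          (FiberBundle.mem_baseSet_trivializationAt' b))
        ((chartAt (EuclideanSpace ℝ (Fin d)) b).open_source.mem_nhds (mem_chart_source _ b))
    have h := HasDualExpansion.sum Finset.univ fun k _ =>
      hasDualExpansion_centralSection (P.isCentredSmooth_ρ k) (P.isCentredSmooth_χ k)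
        (fun x hx => by
          filter_upwards [P.χ_eq_one k x (by simpa using hx)] with y hy
          rw [hy, Complex.ofReal_one]) o
    convert h
    refine Subtype.ext (EndSec.ext_evalAt fun x => ?_)
    rw [AddSubmonoidClass.coe_finsetSum, map_sum]
    change (1 : E x →L[ℂ] E x) = ∑ k, (P.ρ k x : ℂ) • (1 : E x →L[ℂ] E x)
    rw [← Finset.sum_smul, ← Complex.ofReal_sum, P.sum_ρ, Complex.ofReal_one, one_smul]

end Expansion

end DerCalculus

end

theorem mainTheorem5 {d n : ℕ} {M : Type*} [TopologicalSpace M]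
    [ChartedSpace (EuclideanSpace ℝ (Fin d)) M] [IsManifold (𝓡 d) ∞ M]
    [T2Space M] [ParacompactSpace M]
    (E : M → Type*) [∀ x, AddCommGroup (E x)] [∀ x, Module ℂ (E x)]
    [∀ x, TopologicalSpace (E x)] [∀ x, IsTopologicalAddGroup (E x)]
    [∀ x, ContinuousSMul ℂ (E x)]
    [TopologicalSpace (Bundle.TotalSpace (EuclideanSpace ℂ (Fin n)) E)]
    [FiberBundle (EuclideanSpace ℂ (Fin n)) E]
    [VectorBundle ℂ (EuclideanSpace ℂ (Fin n)) E]
    [ContMDiffVectorBundle ∞ (EuclideanSpace ℂ (Fin n)) E (𝓡 d)] :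
    (∀ (p : ℕ) (η : DerCalculus.Form (DerCalculus.EndSec (d := d) n E) p),
      ∃ (m : ℕ) (a₀ : Fin m → DerCalculus.EndSec (d := d) n E)
        (a : Fin m → Fin p → DerCalculus.EndSec (d := d) n E),
        η = ∑ k, DerCalculus.word (a₀ k) (a k)) ∧
    DerCalculus.Omega (DerCalculus.EndSec (d := d) n E) = ⊤ := by
  have h := DerCalculus.hasDualExpansion_one (d := d) (n := n) (E := E)
  exact ⟨fun p η => h.mem_wordSums η, DerCalculus.Omega_eq_top fun p η => h.mem_wordSums η⟩
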